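/- **Theorem 4 (Random design, weakly piecewise polynomial).** Fix an integer $k\ge 0$, exponents $q_1,q_2\in(0,1)$ and constants $\sigma_x>0$ and $c,c'>0$. A random variable $Y$ is called $\sigma$-sub-Gaussian if $\mathbb E Y=0$ and $\mathbb E e^{tY}\le e^{\sigma^2t^2/2}$ for all $t\in\mathbb R$; a random vector $Y$ is $\sigma$-sub-Gaussian if $\mathbb E Y=0$ and $u^TY$ is $\sigma$-sub-Gaussian for every Euclidean unit vector $u$. Let $\mathcal G$ be a graph on $n$ nodes with maximum degree $d$. Let $F$ be its oriented incidence matrix (the row of the edge $(i,j)$, $i<j$, has $-1$ in entry $i$, $+1$ in entry $j$, and $0$ elsewhere), $L=F^TF$ its Laplacian, and let $\Delta^{(k+1)}=FL^{k/2}$ for even $k$ and $\Delta^{(k+1)}=L^{(k+1)/2}$ for odd $k$. For $R_1,R_2>0$ put $$\mathcal S(k,q_1,q_2,R_1,R_2)=\Big\{\beta\in\mathbb R^n:\ \sum_i\big|(\Delta^{(k+1)}\beta)_i\big|^{q_1}\le R_1,\ \ \sum_j|\beta_j|^{q_2}\le R_2\Big\}.$$ Consider the linear model $y=X\beta^*+\varepsilon$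 with $\beta^*\in\mathcal S(k,q_1,q_2,R_1,R_2)$, where the rows of $X\in\mathbb R^{N\times n}$ are i.i.d. $\sigma_x$-sub-Gaussian vectors with covariance matrix $\Sigma_x$ all of whose eigenvalues lie in $[c,c']$, the components of $\varepsilon\in\mathbb R^N$ are i.i.d. $\sigma_\varepsilon$-sub-Gaussian, and $\varepsilon$ is independent of $X$. For $\lambda,\lambda_g\ge0$ let $\hat\beta$ be any minimizer over $\beta\in\mathbb R^n$ of $$\frac1{2N}\|y-X\beta\|_2^2+\lambda_g\|\Delta^{(k+1)}\beta\|_1+\lambda\|\beta\|_1 .$$ Then there is a constant $C_0>0$, depending only on $\sigma_x,c,c'$, with the following property. Consider a sequence of such models in which $N\to\infty$ and $n\to\infty$, while $\mathcal G$, $\beta^*$, $R_1$, $R_2$, $\Sigma_x$, $\sigma_\varepsilon$ and the distributions may vary along the sequence; $\sigma_\varepsilon$ is a positive constant or, more generally, is bounded below by a positive constant. Assume that, for some constants $C_1$ and $K$, all along the sequence $$C_0\,\sigma_\varepsilon\sqrt{\tfrac{\log n}{N}}\le\lambda\le C_1\,\sigma_\varepsilon\sqrt{\tfrac{\log n}{N}},\qquad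 \lambda_g=2^{-(1+k/2)}d^{-(k+1)/2}\lambda,$$ $$R_1\Big(\tfrac{\log n}{N}\Big)^{1-\frac{q_1}2}+R_2\Big(\tfrac{\log n}{N}\Big)^{1-\frac{q_2}2}\le K$$ (if $d=0$, then $\Delta^{(k+1)}\beta=0$ for all $\beta$ and the value of $\lambda_g$ is immaterial). Then: (a) both $\|\hat\beta-\beta^*\|_2^2$ and $\frac1N\|X(\hat\beta-\beta^*)\|_2^2$ are $$\mathcal O_{\mathbb P}\Big(\sigma_\varepsilon^2\Big(R_1\Big(\tfrac{\log n}{N}\Big)^{1-\frac{q_1}2}+R_2\Big(\tfrac{\log n}{N}\Big)^{1-\frac{q_2}2}\Big)\Big);$$ (b) $\displaystyle \|\hat\beta-\beta^*\|_1^2=\mathcal O_{\mathbb P}\Big(\sigma_\varepsilon^2\Big(R_1^2\Big(\tfrac{\log n}{N}\Big)^{1-q_1}+R_2^2\Big(\tfrac{\log n}{N}\Big)^{1-q_2}\Big)\Big).$ Here $Y=\mathcal O_{\mathbb P}(a)$ means: for every $\delta>0$ there is $M>0$ such that $\mathbb P(|Y|>Ma)\le\delta$ for all models far enough along the sequence.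 -/

import Mathlib

open MeasureTheory ProbabilityTheory Filter

noncomputable section

namespace GraphLasso

/-! ### Graph difference operators -/

/-- The edges `(i, j)` with `i < j` of an undirected graph on the nodes `0, …, n - 1`. -/
abbrev Edge {n : ℕ} (G : SimpleGraph (Fin n)) : Type :=
  {e : Fin n × Fin n // e.1 < e.2 ∧ G.Adj e.1 e.2}

instance instFintypeEdge {n : ℕ} (G : SimpleGraph (Fin n)) : Fintype (Edge G) :=
  Fintype.ofFinite _

/-- The oriented incidence matrix `F`: the row of the edge `(i, j)`, `i < j`, has `-1` in
entry `i`, `+1` in entry `j` and `0` elsewhere. -/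
def incidence {n : ℕ} (G : SimpleGraph (Fin n)) : Matrix (Edge G) (Fin n) ℝ :=
  fun e v => if v = e.1.1 then -1 else if v = e.1.2 then 1 else 0

/-- The graph Laplacian `L = Fᵀ F`. -/
def laplacian {n : ℕ} (G : SimpleGraph (Fin n)) : Matrix (Fin n) (Fin n) ℝ :=
  (incidence G).transpose * incidence G

/-- Row index of a graph difference operator: edges (`false`) or nodes (`true`). -/
def DiffRow {n : ℕ} (G : SimpleGraph (Fin n)) : Bool → Type
  | false => Edge G
  | true => Fin n

instance instFintypeDiffRow {n : ℕ} (G : SimpleGraph (Fin n)) :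
    (b : Bool) → Fintype (DiffRow G b)
  | false => instFintypeEdge G
  | true => Fin.fintype n

/-- `F L^(k/2)` (edge rows) and `L^((k+1)/2)` (node rows). -/
def diffAux {n : ℕ} (G : SimpleGraph (Fin n)) (k : ℕ) :
    (b : Bool) → Matrix (DiffRow G b) (Fin n) ℝ
  | false => (incidence G * laplacian G ^ (k / 2) : Matrix (Edge G) (Fin n) ℝ)
  | true => (laplacian G ^ ((k + 1) / 2) : Matrix (Fin n) (Fin n) ℝ)

/-- The graph difference operator `Δ^(k+1)` of order `k + 1`: it is `F L^(k/2)` for even `k` and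
`L^((k+1)/2)` for odd `k` (`k.bodd` is `true` exactly when `k` is odd). -/
def graphDiff {n : ℕ} (G : SimpleGraph (Fin n)) (k : ℕ) :
    Matrix (DiffRow G k.bodd) (Fin n) ℝ :=
  diffAux G k k.bodd

open Classical in
/-- The maximum degree of the graph. -/
def maxDeg {n : ℕ} (G : SimpleGraph (Fin n)) : ℕ := G.maxDegree

/-- The parameter space `S(k, q₁, q₂, R₁, R₂)` of coefficient vectors that are simultaneously
`(k, q₁, R₁)`-weakly piecewise polynomial and `(q₂, R₂)`-weakly sparse. -/
def weakSpace {n : ℕ} (G : SimpleGraph (Fin n)) (k : ℕ) (q₁ q₂ R₁ R₂ : ℝ) :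
    Set (Fin n → ℝ) :=
  {β | ∑ i, |(graphDiff G k).mulVec β i| ^ q₁ ≤ R₁ ∧ ∑ j, |β j| ^ q₂ ≤ R₂}

/-! ### The estimator -/

/-- The objective function
`(2N)⁻¹ ‖y - Xβ‖₂² + λ_g ‖Δ^(k+1) β‖₁ + λ ‖β‖₁`. -/
def objective {N n : ℕ} (G : SimpleGraph (Fin n)) (k : ℕ) (lamg lam : ℝ)
    (X : Matrix (Fin N) (Fin n) ℝ) (y : Fin N → ℝ) (β : Fin n → ℝ) : ℝ :=
  1 / (2 * (N : ℝ)) * ∑ i, (y i - X.mulVec β i) ^ 2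
    + lamg * ∑ i, |(graphDiff G k).mulVec β i| + lam * ∑ j, |β j|

/-- `b` is a `k`-th order Graph-Piecewise-Polynomial-Lasso estimate: a global minimizer of the
objective function. -/
def IsGPPLasso {N n : ℕ} (G : SimpleGraph (Fin n)) (k : ℕ) (lamg lam : ℝ)
    (X : Matrix (Fin N) (Fin n) ℝ) (y : Fin N → ℝ) (b : Fin n → ℝ) : Prop :=
  ∀ β : Fin n → ℝ, objective G k lamg lam X y b ≤ objective G k lamg lam X y β

/-! ### Sub-Gaussian random variables, vectors and matrices -/

/-- A `σ`-sub-Gaussian random variable: mean zero and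
`E[exp (t Y)] ≤ exp (σ² t² / 2)` for all real `t`. -/
def IsSubGaussian {Ω : Type*} [MeasurableSpace Ω] (P : Measure Ω) (Y : Ω → ℝ) (σ : ℝ) : Prop :=
  ∫ ω, Y ω ∂P = 0 ∧ HasSubgaussianMGF Y ⟨σ ^ 2, sq_nonneg σ⟩ P

/-- A `σ`-sub-Gaussian random vector: mean zero, and `uᵀ Y` is `σ`-sub-Gaussian for every
Euclidean unit vector `u`. -/
def IsSubGaussianVec {Ω : Type*} [MeasurableSpace Ω] {n : ℕ} (P : Measure Ω)
    (Y : Ω → Fin n → ℝ) (σ : ℝ) : Prop :=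
  (∀ j, ∫ ω, Y ω j ∂P = 0) ∧
    ∀ u : Fin n → ℝ, ∑ j, u j ^ 2 = 1 → IsSubGaussian P (fun ω => ∑ j, u j * Y ω j) σ

/-- A row-wise `(σ, S)`-sub-Gaussian random matrix: the rows are i.i.d. draws from a
`σ`-sub-Gaussian distribution with covariance matrix `S`. -/
structure IsRowwiseSubGaussian {Ω : Type*} [MeasurableSpace Ω] {N n : ℕ} (P : Measure Ω)
    (X : Ω → Fin N → Fin n → ℝ) (σ : ℝ) (S : Matrix (Fin n) (Fin n) ℝ) : Prop where
  measurable : Measurable X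
  indep : iIndepFun (fun i ω => X ω i) P
  identDistrib : ∀ i i', IdentDistrib (fun ω => X ω i) (fun ω => X ω i') P P
  subGaussian : ∀ i, IsSubGaussianVec P (fun ω => X ω i) σ
  covariance : ∀ i a b, cov[fun ω => X ω i a, fun ω => X ω i b; P] = S a b

/-- A noise vector whose components are i.i.d. draws from a `σ`-sub-Gaussian distribution. -/
structure IsSubGaussianNoise {Ω : Type*} [MeasurableSpace Ω] {N : ℕ} (P : Measure Ω)
    (ε : Ω → Fin N → ℝ) (σ : ℝ) : Prop where
  measurable : Measurable ε
  indep : iIndepFun (fun i ω => ε ω i) P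
  identDistrib : ∀ i i', IdentDistrib (fun ω => ε ω i) (fun ω => ε ω i') P P
  subGaussian : ∀ i, IsSubGaussian P (fun ω => ε ω i) σ

/-! ### Stochastic boundedness -/

/-- `Y t = O_P(a t)` as `t → ∞`, where `Y t` lives on the probability space `(Ω t, P t)`: for every
`δ > 0` there is a constant `M` with `P(|Y t| > M |a t|) ≤ δ` for all large `t`. -/
def IsBigOP {Ω : ℕ → Type*} [∀ t, MeasurableSpace (Ω t)] (P : ∀ t, Measure (Ω t))
    (Y : ∀ t, Ω t → ℝ) (a : ℕ → ℝ) : Prop :=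
  ∀ δ : ℝ, 0 < δ → ∃ M : ℝ, 0 < M ∧
    ∀ᶠ t in atTop, P t {ω | M * |a t| < |Y t ω|} ≤ ENNReal.ofReal δ

end GraphLasso

end

/-!
On the event that the scores satisfy `‖N⁻¹ Xᵀ ε‖_∞ ≤ lam / 4`, minimality of `βhat` gives the basic
inequality for `v = βhat - βstar`. Since the prescribed `lamg` makes `lamg * ‖Δ v‖₂ ≤ lam * ‖v‖₂`,
splitting `Δ βstar` and `βstar` at a truncation level `η` turns weak sparsity into a cone-type
inequality whose effective sparsity is `R₁ η ^ (-q₁) + R₂ η ^ (-q₂)`. A restricted eigenvalue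
condition whose `ℓ₁`-tolerance is of order `log n / N` then bounds the three errors
simultaneously, and the choice `η ≍ √(log n / N)` gives the rates. That condition holds with
probability tending to one: for a fixed direction the empirical second moment has a one-sided
Bernstein lower tail, a union bound covers the averages of few signed basis vectors, and Maurey's
sparsification extends the bound to all vectors at the price of the `ℓ₁`-tolerance. The scores are
sub-Gaussian conditionally on the noise, whose energy is of order `N` with high probability.
-/

namespace GraphLasso

section GraphDifference

open scoped Matrix.Norms.L2Operator

lemma sqrt_sum_sq_mulVec_le {ι κ : Type*} [Fintype ι] [Fintype κ] [DecidableEq κ]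
    (M : Matrix ι κ ℝ) (v : κ → ℝ) :
    √(∑ i, M.mulVec v i ^ 2) ≤ ‖M‖ * √(∑ j, v j ^ 2) := by
  simpa [EuclideanSpace.norm_eq] using M.l2_opNorm_mulVec (WithLp.toLp 2 v)

lemma norm_sq_le_of_sum_sq_mulVec_le {ι κ : Type*} [Fintype ι] [Fintype κ] [DecidableEq κ]
    {M : Matrix ι κ ℝ} {b : ℝ} (hb : 0 ≤ b)
    (hM : ∀ v, ∑ i, M.mulVec v i ^ 2 ≤ b * ∑ j, v j ^ 2) : ‖M‖ ^ 2 ≤ b := by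
  rw [← Real.sq_sqrt hb]
  gcongr
  rw [Matrix.l2_opNorm_def]
  refine ContinuousLinearMap.opNorm_le_bound _ (Real.sqrt_nonneg b) fun v => ?_
  simpa [EuclideanSpace.norm_eq, Real.sqrt_mul hb] using Real.sqrt_le_sqrt (hM v.ofLp)

variable {n : ℕ} (G : SimpleGraph (Fin n)) (k : ℕ)

lemma incidence_mulVec_apply (v : Fin n → ℝ) (e : Edge G) :
    (incidence G).mulVec v e = v e.1.2 - v e.1.1 := by
  have hrow (x : Fin n) : incidence G e x * v x
      = (if x = e.1.2 then v x else 0) - (if x = e.1.1 then v x else 0) := by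
    have := e.2.1.ne
    unfold incidence
    grind
  simp only [Matrix.mulVec, dotProduct, hrow, Finset.sum_sub_distrib, Finset.sum_ite_eq',
    Finset.mem_univ, if_true]

open Classical in
lemma sum_edge_eq_sum_ite (f : Fin n → Fin n → ℝ) :
    ∑ e : Edge G, f e.1.1 e.1.2 = ∑ i, ∑ j, if i < j ∧ G.Adj i j then f i j else 0 := by
  rw [← Fintype.sum_prod_type' fun i j => if i < j ∧ G.Adj i j then f i j else 0,
    ← Finset.sum_filter]
  exact (Finset.sum_subtype (p := fun e : Fin n × Fin n => e.1 < e.2 ∧ G.Adj e.1 e.2) _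
    (by simp) fun e => f e.1 e.2).symm

open Classical in
lemma sum_edge_add_eq_sum_degree_mul (w : Fin n → ℝ) :
    ∑ e : Edge G, (w e.1.1 + w e.1.2) = ∑ i, G.degree i * w i := by
  rw [Finset.sum_add_distrib, sum_edge_eq_sum_ite G fun i _ => w i,
    sum_edge_eq_sum_ite G fun _ j => w j,
    Finset.sum_comm (f := fun i j => if i < j ∧ G.Adj i j then w j else 0),
    ← Finset.sum_add_distrib]
  refine Finset.sum_congr rfl fun i _ => ?_
  rw [← G.card_neighborFinset_eq_degree, G.neighborFinset_eq_filter, ← nsmul_eq_mul,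
    ← Finset.sum_const, Finset.sum_filter, ← Finset.sum_add_distrib]
  refine Finset.sum_congr rfl fun j _ => ?_
  by_cases hij : G.Adj i j
  · rcases lt_or_gt_of_ne hij.ne with h | h <;> simp [h, hij, hij.symm, h.not_gt]
  · simp [hij, G.adj_comm j i]

lemma sum_sq_incidence_mulVec_le (v : Fin n → ℝ) :
    ∑ e, (incidence G).mulVec v e ^ 2 ≤ 2 * maxDeg G * ∑ i, v i ^ 2 := by
  classical
  calc ∑ e, (incidence G).mulVec v e ^ 2
      ≤ ∑ e : Edge G, 2 * (v e.1.1 ^ 2 + v e.1.2 ^ 2) := by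
        refine Finset.sum_le_sum fun e _ => ?_
        rw [incidence_mulVec_apply]
        nlinarith only [sq_nonneg (v e.1.2 + v e.1.1)]
    _ = 2 * ∑ i, G.degree i * v i ^ 2 := by
        rw [← Finset.mul_sum, sum_edge_add_eq_sum_degree_mul G fun i => v i ^ 2]
    _ ≤ 2 * ∑ i, maxDeg G * v i ^ 2 := by
        gcongr with i
        rw [maxDeg]
        convert G.degree_le_maxDegree i
    _ = _ := by rw [← Finset.mul_sum, mul_assoc]

lemma norm_incidence_sq_le : ‖incidence G‖ ^ 2 ≤ 2 * maxDeg G :=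
  norm_sq_le_of_sum_sq_mulVec_le (by positivity) (sum_sq_incidence_mulVec_le G)

lemma norm_laplacian : ‖laplacian G‖ = ‖incidence G‖ ^ 2 := by
  simpa [laplacian, sq] using (incidence G).l2_opNorm_conjTranspose_mul_self

lemma norm_incidence_mul_laplacian_pow_le (m : ℕ) :
    ‖incidence G * laplacian G ^ m‖ ≤ ‖incidence G‖ ^ (2 * m + 1) := by
  induction m with
  | zero => simp
  | succ m ih =>
    calc ‖incidence G * laplacian G ^ (m + 1)‖
        = ‖incidence G * laplacian G ^ m * laplacian G‖ := by rw [pow_succ, Matrix.mul_assoc]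
      _ ≤ ‖incidence G * laplacian G ^ m‖ * ‖laplacian G‖ := Matrix.l2_opNorm_mul _ _
      _ ≤ ‖incidence G‖ ^ (2 * m + 1) * ‖incidence G‖ ^ 2 := by rw [norm_laplacian]; gcongr
      _ = _ := by ring

lemma norm_diffAux_le {b : Bool} (hb : k.bodd = b) :
    ‖diffAux G k b‖ ≤ ‖incidence G‖ ^ (k + 1) := by
  have hk := Nat.bodd_add_div2 k
  rw [hb, Nat.div2_val] at hk
  cases b with
  | false =>
    have hk' : k + 1 = 2 * (k / 2) + 1 := by simpa [eq_comm] using hk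
    rw [hk']
    exact norm_incidence_mul_laplacian_pow_le G (k / 2)
  | true =>
    have hk' : k + 1 = 2 * ((k + 1) / 2) := by simp only [Bool.toNat_true] at hk; lia
    calc ‖laplacian G ^ ((k + 1) / 2)‖ ≤ ‖laplacian G‖ ^ ((k + 1) / 2) :=
          norm_pow_le' _ (by lia)
      _ = ‖incidence G‖ ^ (2 * ((k + 1) / 2)) := by rw [norm_laplacian, pow_mul]
      _ = ‖incidence G‖ ^ (k + 1) := by rw [← hk']

lemma norm_graphDiff_le : ‖graphDiff G k‖ ≤ √(2 * maxDeg G) ^ (k + 1) :=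
  (norm_diffAux_le G k rfl).trans (by gcongr; exact Real.le_sqrt_of_sq_le (norm_incidence_sq_le G))

lemma rpow_neg_half_mul_sqrt_pow_le_one {x : ℝ} (hx : 0 ≤ x) :
    x ^ (-(((k : ℝ) + 1) / 2)) * √x ^ (k + 1) ≤ 1 := by
  rcases hx.eq_or_lt with rfl | hx
  · simp
  · rw [Real.sqrt_eq_rpow, ← Real.rpow_natCast, ← Real.rpow_mul hx.le, ← Real.rpow_add hx]
    apply le_of_eq
    convert Real.rpow_zero x using 2
    push_cast
    ring

lemma rpow_mul_natCast_rpow_le (d : ℕ) :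
    (2 : ℝ) ^ (-(1 + (k : ℝ) / 2)) * (d : ℝ) ^ (-(((k : ℝ) + 1) / 2))
      ≤ (2 * d) ^ (-(((k : ℝ) + 1) / 2)) := by
  rw [Real.mul_rpow zero_le_two d.cast_nonneg]
  gcongr
  · exact one_le_two
  · linarith

lemma two_mul_natCast_rpow_le_one (d : ℕ) : (2 * (d : ℝ)) ^ (-(((k : ℝ) + 1) / 2)) ≤ 1 := by
  have hk : (0 : ℝ) < ((k : ℝ) + 1) / 2 := by positivity
  rcases Nat.eq_zero_or_pos d with rfl | hd
  · simp [Real.zero_rpow (neg_ne_zero.2 hk.ne')]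
  · have hd' : (1 : ℝ) ≤ d := by exact_mod_cast hd
    exact Real.rpow_le_one_of_one_le_of_nonpos (by linarith) (by linarith)

/-- The penalty `lamg * ‖D β‖₁` is dominated by the penalty `lam * ‖β‖₁`: the level `lamg` is at
most `lam`, and `lamg • D` has Euclidean operator norm at most `lam`. -/
structure IsAdmissiblePenalty {m : Type*} [Fintype m] (D : Matrix m (Fin n) ℝ)
    (lamg lam : ℝ) : Prop where
  nonneg : 0 ≤ lamg
  le : lamg ≤ lam
  mul_norm_le : lamg * ‖D‖ ≤ lam

lemma IsAdmissiblePenalty.mul_sqrt_sum_sq_le {m : Type*} [Fintype m] {D : Matrix m (Fin n) ℝ}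
    {lamg lam : ℝ} (hD : IsAdmissiblePenalty D lamg lam) (v : Fin n → ℝ) :
    lamg * √(∑ i, D.mulVec v i ^ 2) ≤ lam * √(∑ j, v j ^ 2) :=
  calc lamg * √(∑ i, D.mulVec v i ^ 2)
      ≤ lamg * (‖D‖ * √(∑ j, v j ^ 2)) :=
        mul_le_mul_of_nonneg_left (sqrt_sum_sq_mulVec_le D v) hD.nonneg
    _ = lamg * ‖D‖ * √(∑ j, v j ^ 2) := (mul_assoc ..).symm
    _ ≤ lam * √(∑ j, v j ^ 2) := mul_le_mul_of_nonneg_right hD.mul_norm_le (Real.sqrt_nonneg _)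

lemma isAdmissiblePenalty_graphDiff {lam : ℝ} (hlam : 0 ≤ lam) :
    IsAdmissiblePenalty (graphDiff G k)
      ((2 : ℝ) ^ (-(1 + (k : ℝ) / 2)) * (maxDeg G : ℝ) ^ (-(((k : ℝ) + 1) / 2)) * lam) lam := by
  have hratio := rpow_mul_natCast_rpow_le k (maxDeg G)
  refine ⟨by positivity, mul_le_of_le_one_left hlam
    (hratio.trans (two_mul_natCast_rpow_le_one k (maxDeg G))), ?_⟩
  rw [mul_right_comm]
  refine mul_le_of_le_one_left hlam ?_
  calc _ ≤ (2 * (maxDeg G : ℝ)) ^ (-(((k : ℝ) + 1) / 2)) * √(2 * maxDeg G) ^ (k + 1) :=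
        mul_le_mul hratio (norm_graphDiff_le G k) (norm_nonneg _) (by positivity)
    _ ≤ 1 := rpow_neg_half_mul_sqrt_pow_le_one k (by positivity)

end GraphDifference

section WeakSparsity

variable {ι : Type*} [Fintype ι]

lemma card_mul_rpow_le_sum_rpow (u : ι → ℝ) {q η : ℝ} (hq : 0 ≤ q) (hη : 0 ≤ η) :
    ((Finset.univ.filter fun i => η < |u i|).card : ℝ) * η ^ q ≤ ∑ i, |u i| ^ q := by
  rw [← nsmul_eq_mul]
  refine (Finset.card_nsmul_le_sum _ (fun i => |u i| ^ q) _ fun i hi => ?_).trans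
    (Finset.sum_le_univ_sum_of_nonneg fun i => by positivity)
  exact Real.rpow_le_rpow hη (Finset.mem_filter.1 hi).2.le hq

lemma sum_abs_le_rpow_mul_sum_rpow (u : ι → ℝ) {q η : ℝ} (hq : q ≤ 1) (hη : 0 ≤ η)
    {s : Finset ι} (hs : ∀ i ∈ s, |u i| ≤ η) :
    ∑ i ∈ s, |u i| ≤ η ^ (1 - q) * ∑ i, |u i| ^ q := by
  calc ∑ i ∈ s, |u i| ≤ ∑ i ∈ s, η ^ (1 - q) * |u i| ^ q := by
        refine Finset.sum_le_sum fun i hi => ?_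
        calc |u i| = |u i| ^ ((1 - q) + q) := by simp
          _ = |u i| ^ (1 - q) * |u i| ^ q := Real.rpow_add' (abs_nonneg _) (by simp)
          _ ≤ η ^ (1 - q) * |u i| ^ q := by
            gcongr
            exact hs i hi
    _ ≤ η ^ (1 - q) * ∑ i, |u i| ^ q := by
        rw [← Finset.mul_sum]
        exact mul_le_mul_of_nonneg_left
          (Finset.sum_le_univ_sum_of_nonneg fun i => by positivity) (by positivity)

open Classical in
lemma sum_abs_sub_add_sum_abs_sub_le (u u' : ι → ℝ) (s : Finset ι) :
    ∑ i, |u i| - ∑ i, |u' i| + ∑ i, |u' i - u i|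
      ≤ 2 * (∑ i ∈ s, |u' i - u i| + ∑ i ∈ sᶜ, |u i|) := by
  have hs (i : ι) : |u i| - |u' i| + |u' i - u i| ≤ 2 * |u' i - u i| := by
    linarith [abs_sub_abs_le_abs_sub (u i) (u' i), abs_sub_comm (u i) (u' i)]
  have hsc (i : ι) : |u i| - |u' i| + |u' i - u i| ≤ 2 * |u i| := by
    linarith [abs_sub (u' i) (u i)]
  rw [← Finset.sum_sub_distrib, ← Finset.sum_add_distrib, ← Finset.sum_add_sum_compl s, mul_add,
    Finset.mul_sum, Finset.mul_sum]
  exact add_le_add (Finset.sum_le_sum fun i _ => hs i) (Finset.sum_le_sum fun i _ => hsc i)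

lemma sum_abs_le_sqrt_card_mul_sqrt (h : ι → ℝ) (s : Finset ι) :
    ∑ i ∈ s, |h i| ≤ √s.card * √(∑ i, h i ^ 2) := by
  rw [← Real.sqrt_mul (Nat.cast_nonneg _)]
  refine Real.le_sqrt_of_sq_le (sq_sum_le_card_mul_sum_sq.trans ?_)
  simp only [sq_abs]
  gcongr
  exact s.subset_univ

-- The effective support of `u` is the set of entries exceeding `η`: it has at most `R * η ^ (-q)`
-- elements, and the remaining entries sum to at most `η * (R * η ^ (-q))`.
lemma sum_abs_sub_add_sum_abs_sub_le_of_sum_rpow_le {u : ι → ℝ} {q R η : ℝ} (hq₀ : 0 ≤ q)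
    (hq₁ : q ≤ 1) (hη : 0 < η) (hR : ∑ i, |u i| ^ q ≤ R) (u' : ι → ℝ) :
    ∑ i, |u i| - ∑ i, |u' i| + ∑ i, |u' i - u i|
      ≤ 2 * (√(R * η ^ (-q)) * √(∑ i, (u' i - u i) ^ 2) + η * (R * η ^ (-q))) := by
  classical
  set s := Finset.univ.filter fun i => η < |u i|
  have hcard : (s.card : ℝ) ≤ R * η ^ (-q) := by
    rw [Real.rpow_neg hη.le, ← div_eq_mul_inv, le_div_iff₀ (by positivity)]
    exact (card_mul_rpow_le_sum_rpow u hq₀ hη.le).trans hR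
  have htail : ∑ i ∈ sᶜ, |u i| ≤ η * (R * η ^ (-q)) := by
    calc ∑ i ∈ sᶜ, |u i| ≤ η ^ (1 - q) * ∑ i, |u i| ^ q :=
          sum_abs_le_rpow_mul_sum_rpow u hq₁ hη.le fun i hi => by simpa [s] using hi
      _ ≤ η ^ (1 - q) * R := by gcongr
      _ = η * (R * η ^ (-q)) := by rw [sub_eq_add_neg, Real.rpow_add hη, Real.rpow_one]; ring
  refine (sum_abs_sub_add_sum_abs_sub_le u u' s).trans ?_
  gcongr
  exact (sum_abs_le_sqrt_card_mul_sqrt _ s).trans (by gcongr)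

end WeakSparsity

section OracleInequality

/-- The effective sparsity, at truncation level `η`, of a vector whose image under the penalty
matrix lies in the weak `ℓ_q₁` ball of radius `R₁` and which itself lies in the weak `ℓ_q₂` ball of
radius `R₂`. -/
noncomputable def effSparsity (q₁ q₂ R₁ R₂ η : ℝ) : ℝ := R₁ * η ^ (-q₁) + R₂ * η ^ (-q₂)

lemma effSparsity_nonneg {q₁ q₂ R₁ R₂ η : ℝ} (hR₁ : 0 ≤ R₁) (hR₂ : 0 ≤ R₂) (hη : 0 ≤ η) :
    0 ≤ effSparsity q₁ q₂ R₁ R₂ η := by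
  unfold effSparsity
  positivity

/-- The objective of the generalized lasso with penalty `lamg * ‖D β‖₁ + lam * ‖β‖₁`; `objective`
is the case where `D` is a graph difference operator. -/
noncomputable def genLassoObjective {N n : ℕ} {m : Type*} [Fintype m] (D : Matrix m (Fin n) ℝ)
    (lamg lam : ℝ) (X : Matrix (Fin N) (Fin n) ℝ) (y : Fin N → ℝ) (β : Fin n → ℝ) : ℝ :=
  1 / (2 * (N : ℝ)) * ∑ i, (y i - X.mulVec β i) ^ 2
    + lamg * ∑ i, |D.mulVec β i| + lam * ∑ j, |β j|

/-- The restricted eigenvalue condition for the Gram matrix of `X` with curvature `κ` and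
`ℓ₁`-tolerance `τ`. -/
def RestrictedEigenvalue {N n : ℕ} (X : Matrix (Fin N) (Fin n) ℝ) (κ τ : ℝ) : Prop :=
  ∀ v : Fin n → ℝ,
    κ * ∑ j, v j ^ 2 ≤ 1 / (N : ℝ) * ∑ i, X.mulVec v i ^ 2 + τ * (∑ j, |v j|) ^ 2

variable {N n : ℕ} {m : Type*} [Fintype m] {D : Matrix m (Fin n) ℝ} {lamg lam : ℝ}
  {X : Matrix (Fin N) (Fin n) ℝ} {ε : Fin N → ℝ} {βs b : Fin n → ℝ}

lemma sum_mul_mulVec_le {ι κ : Type*} [Fintype ι] [Fintype κ] {A : Matrix ι κ ℝ} {e : ι → ℝ}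
    {B : ℝ} (hB : ∀ j, |∑ i, A i j * e i| ≤ B) (v : κ → ℝ) :
    ∑ i, e i * A.mulVec v i ≤ B * ∑ j, |v j| := by
  calc ∑ i, e i * A.mulVec v i = ∑ j, (∑ i, A i j * e i) * v j := by
        simp only [Matrix.mulVec, dotProduct, Finset.mul_sum, Finset.sum_mul]
        rw [Finset.sum_comm]
        exact Finset.sum_congr rfl fun j _ => Finset.sum_congr rfl fun i _ => by ring
    _ ≤ ∑ j, B * |v j| := by
        refine Finset.sum_le_sum fun j _ => (le_abs_self _).trans ?_
        rw [abs_mul]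
        exact mul_le_mul_of_nonneg_right (hB j) (abs_nonneg _)
    _ = B * ∑ j, |v j| := (Finset.mul_sum ..).symm

lemma prediction_error_le (hN : 0 < N)
    (hb : IsMinOn (genLassoObjective D lamg lam X (X.mulVec βs + ε)) Set.univ b)
    (hnoise : ∀ j, |∑ i, X i j * ε i| ≤ N * (lam / 4)) :
    1 / (N : ℝ) * ∑ i, X.mulVec (b - βs) i ^ 2
      ≤ 2 * (lamg * (∑ i, |D.mulVec βs i| - ∑ i, |D.mulVec b i|)
        + lam * (∑ j, |βs j| - ∑ j, |b j|) + lam / 4 * ∑ j, |(b - βs) j|) := by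
  have hN' : (0 : ℝ) < N := by exact_mod_cast hN
  have hmin : genLassoObjective D lamg lam X (X.mulVec βs + ε) b ≤ _ := hb (Set.mem_univ βs)
  set v := b - βs with hv
  have hXb (i : Fin N) : X.mulVec b i = X.mulVec βs i + X.mulVec v i := by
    simp [hv, Matrix.mulVec_sub]
  have hsq : ∑ i, (ε i - X.mulVec v i) ^ 2
      = ∑ i, ε i ^ 2 - 2 * ∑ i, ε i * X.mulVec v i + ∑ i, X.mulVec v i ^ 2 := by
    rw [Finset.mul_sum, ← Finset.sum_sub_distrib, ← Finset.sum_add_distrib]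
    exact Finset.sum_congr rfl fun i _ => by ring
  simp only [genLassoObjective, Pi.add_apply, hXb, add_sub_cancel_left, add_sub_add_left_eq_sub,
    hsq] at hmin
  have hcross : 1 / (N : ℝ) * ∑ i, ε i * X.mulVec v i ≤ lam / 4 * ∑ j, |v j| := by
    rw [one_div, inv_mul_le_iff₀ hN', ← mul_assoc]
    exact sum_mul_mulVec_le hnoise v
  have hsplit (s t u : ℝ) : 1 / (2 * (N : ℝ)) * (s - 2 * t + u)
      = 1 / (2 * N) * s - 1 / N * t + 1 / N * u / 2 := by field_simp
  rw [hsplit] at hmin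
  linarith

lemma sqrt_add_sqrt_le {x y : ℝ} (hx : 0 ≤ x) (hy : 0 ≤ y) : √x + √y ≤ √(2 * (x + y)) := by
  refine Real.le_sqrt_of_sq_le (add_sq_le.trans_eq ?_)
  rw [Real.sq_sqrt hx, Real.sq_sqrt hy]

lemma prediction_error_add_le {q₁ q₂ R₁ R₂ η : ℝ} (hN : 0 < N)
    (hD : IsAdmissiblePenalty D lamg lam)
    (hb : IsMinOn (genLassoObjective D lamg lam X (X.mulVec βs + ε)) Set.univ b)
    (hnoise : ∀ j, |∑ i, X i j * ε i| ≤ N * (lam / 4)) (hq₁ : q₁ ∈ Set.Ioc 0 1)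
    (hq₂ : q₂ ∈ Set.Ioc 0 1) (hη : 0 < η) (hR₁ : ∑ i, |D.mulVec βs i| ^ q₁ ≤ R₁)
    (hR₂ : ∑ j, |βs j| ^ q₂ ≤ R₂) :
    1 / (N : ℝ) * ∑ i, X.mulVec (b - βs) i ^ 2 + 3 / 2 * (lam * ∑ j, |(b - βs) j|)
      ≤ 4 * lam * (√(2 * effSparsity q₁ q₂ R₁ R₂ η) * √(∑ j, (b - βs) j ^ 2)
        + η * effSparsity q₁ q₂ R₁ R₂ η) := by
  have hlam : 0 ≤ lam := hD.nonneg.trans hD.le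
  set s₁ := R₁ * η ^ (-q₁)
  set s₂ := R₂ * η ^ (-q₂)
  have hs₁ : 0 ≤ s₁ := mul_nonneg (le_trans (by positivity) hR₁) (by positivity)
  have hs₂ : 0 ≤ s₂ := mul_nonneg (le_trans (by positivity) hR₂) (by positivity)
  set d := √(∑ j, (b - βs) j ^ 2)
  have hgraph : lamg * (∑ i, |D.mulVec βs i| - ∑ i, |D.mulVec b i|)
      ≤ lam * (2 * (√s₁ * d + η * s₁)) := by
    have hDv (i : m) : D.mulVec b i - D.mulVec βs i = D.mulVec (b - βs) i := by
      simp [Matrix.mulVec_sub]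
    have hweak := sum_abs_sub_add_sum_abs_sub_le_of_sum_rpow_le hq₁.1.le hq₁.2 hη hR₁ (D.mulVec b)
    simp only [hDv] at hweak
    have htotal : 0 ≤ ∑ i, |D.mulVec (b - βs) i| := by positivity
    calc lamg * (∑ i, |D.mulVec βs i| - ∑ i, |D.mulVec b i|)
        ≤ lamg * (2 * (√s₁ * √(∑ i, D.mulVec (b - βs) i ^ 2) + η * s₁)) :=
          mul_le_mul_of_nonneg_left (by linarith) hD.nonneg
      _ = 2 * (√s₁ * (lamg * √(∑ i, D.mulVec (b - βs) i ^ 2)) + lamg * (η * s₁)) := by ring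
      _ ≤ 2 * (√s₁ * (lam * d) + lam * (η * s₁)) := by
          gcongr ?_ * (√s₁ * ?_ + ?_ * _)
          exacts [hD.mul_sqrt_sum_sq_le _, hD.le]
      _ = _ := by ring
  have hsparse : lam * (∑ j, |βs j| - ∑ j, |b j| + ∑ j, |(b - βs) j|)
      ≤ lam * (2 * (√s₂ * d + η * s₂)) :=
    mul_le_mul_of_nonneg_left
      (sum_abs_sub_add_sum_abs_sub_le_of_sum_rpow_le hq₂.1.le hq₂.2 hη hR₂ b) hlam
  have hsqrt : lam * ((√s₁ + √s₂) * d) ≤ lam * (√(2 * (s₁ + s₂)) * d) := by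
    gcongr
    exact sqrt_add_sqrt_le hs₁ hs₂
  have hpred := prediction_error_le hN hb hnoise
  change _ ≤ 4 * lam * (√(2 * (s₁ + s₂)) * d + η * (s₁ + s₂))
  linarith

-- With `λ = κ μ`, the hypothesis on `T` makes the tolerance term of the restricted eigenvalue
-- condition absorb at most a quarter of the curvature `κ d²`.
lemma error_bounds_of_cone {κ T μ h η d w p : ℝ} (hκ : 0 < κ) (hT : 0 ≤ T) (hμ : 0 < μ)
    (hh : 0 ≤ h) (hη : 0 ≤ η) (hw : 0 ≤ w) (hp : 0 ≤ p) (hRE : κ * d ^ 2 ≤ p + T * w ^ 2)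
    (hcone : p + 3 / 2 * (κ * μ * w) ≤ 4 * (κ * μ) * (√(2 * h) * d + η * h))
    (hTh : 128 * T * h ≤ κ) :
    d ^ 2 ≤ (16 * μ + η) ^ 2 * h / 4 ∧ p ≤ κ * ((16 * μ + η) ^ 2 * h / 4) ∧
      w ^ 2 ≤ 24 * (16 * μ + η) ^ 2 * h ^ 2 := by
  set A := √(2 * h)
  have hA : A ^ 2 = 2 * h := Real.sq_sqrt (by positivity)
  have hκμ : 0 < κ * μ := mul_pos hκ hμ
  have hw_le : w ≤ 8 / 3 * (A * d + η * h) := by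
    refine le_of_mul_le_mul_left ?_ hκμ
    linarith
  have hw_sq : w ^ 2 ≤ 32 * h * d ^ 2 + 16 * η ^ 2 * h ^ 2 := by
    calc w ^ 2 ≤ (8 / 3 * (A * d + η * h)) ^ 2 := pow_le_pow_left₀ hw hw_le 2
      _ ≤ 16 * ((A * d) ^ 2 + (η * h) ^ 2) := by
          nlinarith only [sq_nonneg (A * d - η * h), sq_nonneg (A * d), sq_nonneg (η * h)]
      _ = _ := by rw [mul_pow, hA]; ring
  have hTw : T * w ^ 2 ≤ κ / 4 * d ^ 2 + κ / 8 * (η ^ 2 * h) := by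
    calc T * w ^ 2 ≤ T * (32 * h * d ^ 2 + 16 * η ^ 2 * h ^ 2) := by gcongr
      _ = 128 * T * h * (d ^ 2 / 4 + η ^ 2 * h / 8) := by ring
      _ ≤ κ * (d ^ 2 / 4 + η ^ 2 * h / 8) := by gcongr
      _ = _ := by ring
  have hp_le : p ≤ κ / 4 * d ^ 2 + κ * (32 * μ ^ 2 * h + 4 * μ * η * h) := by
    have hyoung : κ * (4 * μ * A * d) ≤ κ * (d ^ 2 / 4 + 16 * μ ^ 2 * A ^ 2) := by
      gcongr
      nlinarith only [sq_nonneg (d - 8 * μ * A)]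
    rw [hA] at hyoung
    nlinarith only [hyoung, hcone, mul_nonneg hκμ.le hw]
  have hd : d ^ 2 ≤ (16 * μ + η) ^ 2 * h / 4 := by
    refine le_of_mul_le_mul_left ?_ hκ
    linarith
  refine ⟨hd, ?_, ?_⟩
  · have hηh : 0 ≤ κ * (η ^ 2 * h) := by positivity
    linarith [mul_le_mul_of_nonneg_left hd hκ.le]
  · calc w ^ 2 ≤ 32 * h * d ^ 2 + 16 * η ^ 2 * h ^ 2 := hw_sq
      _ ≤ 32 * h * ((16 * μ + η) ^ 2 * h / 4) + 16 * (16 * μ + η) ^ 2 * h ^ 2 := by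
          gcongr
          linarith
      _ = _ := by ring

theorem error_bounds {q₁ q₂ R₁ R₂ η κ T : ℝ} (hN : 0 < N)
    (hD : IsAdmissiblePenalty D lamg lam) (hlam : 0 < lam)
    (hb : IsMinOn (genLassoObjective D lamg lam X (X.mulVec βs + ε)) Set.univ b)
    (hnoise : ∀ j, |∑ i, X i j * ε i| ≤ N * (lam / 4)) (hq₁ : q₁ ∈ Set.Ioc 0 1)
    (hq₂ : q₂ ∈ Set.Ioc 0 1) (hη : 0 < η) (hR₁ : ∑ i, |D.mulVec βs i| ^ q₁ ≤ R₁)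
    (hR₂ : ∑ j, |βs j| ^ q₂ ≤ R₂) (hκ : 0 < κ) (hT : 0 ≤ T) (hX : RestrictedEigenvalue X κ T)
    (hsmall : 128 * T * effSparsity q₁ q₂ R₁ R₂ η ≤ κ) :
    ∑ j, (b - βs) j ^ 2 ≤ (16 * (lam / κ) + η) ^ 2 * effSparsity q₁ q₂ R₁ R₂ η / 4 ∧
      1 / (N : ℝ) * ∑ i, X.mulVec (b - βs) i ^ 2
        ≤ κ * ((16 * (lam / κ) + η) ^ 2 * effSparsity q₁ q₂ R₁ R₂ η / 4) ∧
      (∑ j, |(b - βs) j|) ^ 2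
        ≤ 24 * (16 * (lam / κ) + η) ^ 2 * effSparsity q₁ q₂ R₁ R₂ η ^ 2 := by
  have hcone := prediction_error_add_le hN hD hb hnoise hq₁ hq₂ hη hR₁ hR₂
  have hh : 0 ≤ effSparsity q₁ q₂ R₁ R₂ η :=
    effSparsity_nonneg (le_trans (by positivity) hR₁) (le_trans (by positivity) hR₂) hη.le
  have hd : √(∑ j, (b - βs) j ^ 2) ^ 2 = ∑ j, (b - βs) j ^ 2 := Real.sq_sqrt (by positivity)
  rw [← mul_div_cancel₀ lam hκ.ne'] at hcone
  have hRE := hX (b - βs)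
  rw [← hd] at hRE ⊢
  exact error_bounds_of_cone hκ hT (div_pos hlam hκ) hh hη.le (by positivity) (by positivity)
    hRE hcone hsmall

end OracleInequality

section Rates

variable {q₁ q₂ R₁ R₂ : ℝ}

lemma effSparsity_mul_le (hR₁ : 0 ≤ R₁) (hR₂ : 0 ≤ R₂) {a η : ℝ} (ha : 1 ≤ a) (hη : 0 ≤ η) :
    effSparsity q₁ q₂ R₁ R₂ (a * η) ≤ a ^ (-min q₁ q₂) * effSparsity q₁ q₂ R₁ R₂ η := by
  have ha₀ : 0 ≤ a := zero_le_one.trans ha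
  have hterm {q R : ℝ} (hR : 0 ≤ R) (hq : min q₁ q₂ ≤ q) :
      R * (a * η) ^ (-q) ≤ a ^ (-min q₁ q₂) * (R * η ^ (-q)) := by
    rw [Real.mul_rpow ha₀ hη, mul_left_comm]
    gcongr
  rw [effSparsity, effSparsity, mul_add]
  exact add_le_add (hterm hR₁ (min_le_left ..)) (hterm hR₂ (min_le_right ..))

lemma mul_effSparsity_sqrt {ρ : ℝ} (hρ : 0 < ρ) :
    ρ * effSparsity q₁ q₂ R₁ R₂ √ρ = R₁ * ρ ^ (1 - q₁ / 2) + R₂ * ρ ^ (1 - q₂ / 2) := by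
  have hterm (q : ℝ) : ρ * √ρ ^ (-q) = ρ ^ (1 - q / 2) := by
    rw [Real.sqrt_eq_rpow, ← Real.rpow_mul hρ.le, sub_eq_add_neg, Real.rpow_add hρ, Real.rpow_one]
    ring_nf
  rw [effSparsity, ← hterm q₁, ← hterm q₂]
  ring

lemma mul_effSparsity_sqrt_sq_le {ρ : ℝ} (hρ : 0 < ρ) :
    ρ * effSparsity q₁ q₂ R₁ R₂ √ρ ^ 2
      ≤ 2 * (R₁ ^ 2 * ρ ^ (1 - q₁) + R₂ ^ 2 * ρ ^ (1 - q₂)) := by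
  have hterm (q : ℝ) : ρ * (√ρ ^ (-q)) ^ 2 = ρ ^ (1 - q) := by
    rw [← Real.rpow_mul_natCast (Real.sqrt_nonneg ρ), Real.sqrt_eq_rpow, ← Real.rpow_mul hρ.le,
      sub_eq_add_neg, Real.rpow_add hρ, Real.rpow_one]
    congr 2
    push_cast
    ring
  calc ρ * effSparsity q₁ q₂ R₁ R₂ √ρ ^ 2
      ≤ ρ * (2 * ((R₁ * √ρ ^ (-q₁)) ^ 2 + (R₂ * √ρ ^ (-q₂)) ^ 2)) := by
        gcongr
        exact add_sq_le
    _ = 2 * (R₁ ^ 2 * (ρ * (√ρ ^ (-q₁)) ^ 2) + R₂ ^ 2 * (ρ * (√ρ ^ (-q₂)) ^ 2)) := by ring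
    _ = _ := by rw [hterm, hterm]

lemma exists_one_le_rpow_neg_mul_le {q x κ : ℝ} (hq : 0 < q) (hκ : 0 < κ) :
    ∃ a : ℝ, 1 ≤ a ∧ a ^ (-q) * x ≤ κ := by
  have hlim : Tendsto (fun a : ℝ => a ^ (-q) * x) atTop (nhds 0) := by
    simpa using (tendsto_rpow_neg_atTop hq).mul_const x
  exact ((eventually_ge_atTop 1).and (hlim.eventually (eventually_le_nhds hκ))).exists

lemma error_bounds_rate {N n : ℕ} {m : Type*} [Fintype m] {D : Matrix m (Fin n) ℝ}
    {X : Matrix (Fin N) (Fin n) ℝ} {ε : Fin N → ℝ} {βs b : Fin n → ℝ}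
    {lamg lam κ T a ρ σ M : ℝ} (hN : 0 < N) (hD : IsAdmissiblePenalty D lamg lam) (hlam : 0 < lam)
    (hb : IsMinOn (genLassoObjective D lamg lam X (X.mulVec βs + ε)) Set.univ b)
    (hnoise : ∀ j, |∑ i, X i j * ε i| ≤ N * (lam / 4)) (hq₁ : q₁ ∈ Set.Ioc 0 1)
    (hq₂ : q₂ ∈ Set.Ioc 0 1) (hR₁ : ∑ i, |D.mulVec βs i| ^ q₁ ≤ R₁)
    (hR₂ : ∑ j, |βs j| ^ q₂ ≤ R₂) (hκ : 0 < κ) (hT : 0 ≤ T) (hX : RestrictedEigenvalue X κ T)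
    (ha : 1 ≤ a) (hρ : 0 < ρ) (hsmall : 128 * T * effSparsity q₁ q₂ R₁ R₂ (a * √ρ) ≤ κ)
    (hM : (16 * (lam / κ) + a * √ρ) ^ 2 ≤ M * (ρ * σ ^ 2)) :
    ∑ j, (b - βs) j ^ 2
        ≤ M / 4 * (σ ^ 2 * (R₁ * ρ ^ (1 - q₁ / 2) + R₂ * ρ ^ (1 - q₂ / 2))) ∧
      1 / (N : ℝ) * ∑ i, X.mulVec (b - βs) i ^ 2
        ≤ κ * M / 4 * (σ ^ 2 * (R₁ * ρ ^ (1 - q₁ / 2) + R₂ * ρ ^ (1 - q₂ / 2))) ∧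
      (∑ j, |(b - βs) j|) ^ 2
        ≤ 48 * M * (σ ^ 2 * (R₁ ^ 2 * ρ ^ (1 - q₁) + R₂ ^ 2 * ρ ^ (1 - q₂))) := by
  have hR₁_nonneg : 0 ≤ R₁ := le_trans (by positivity) hR₁
  have hR₂_nonneg : 0 ≤ R₂ := le_trans (by positivity) hR₂
  have : 0 < a := zero_lt_one.trans_le ha
  obtain ⟨hd, hp, hw⟩ := error_bounds hN hD hlam hb hnoise hq₁ hq₂ (by positivity) hR₁ hR₂ hκ hT
    hX hsmall
  set s := effSparsity q₁ q₂ R₁ R₂ √ρ with hs_def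
  set sa := effSparsity q₁ q₂ R₁ R₂ (a * √ρ)
  have hsa : 0 ≤ sa := effSparsity_nonneg hR₁_nonneg hR₂_nonneg (by positivity)
  have hs : 0 ≤ s := effSparsity_nonneg hR₁_nonneg hR₂_nonneg (Real.sqrt_nonneg ρ)
  have hsa_le : sa ≤ s :=
    (effSparsity_mul_le hR₁_nonneg hR₂_nonneg ha (Real.sqrt_nonneg ρ)).trans
      (mul_le_of_le_one_left hs
        (Real.rpow_le_one_of_one_le_of_nonpos ha (by linarith [lt_min hq₁.1 hq₂.1])))
  have hscale : (16 * (lam / κ) + a * √ρ) ^ 2 * sa ≤ M * (σ ^ 2 * (ρ * s)) :=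
    (mul_le_mul hM hsa_le hsa ((sq_nonneg _).trans hM)).trans_eq (by ring)
  have hscale_sq : (16 * (lam / κ) + a * √ρ) ^ 2 * sa ^ 2 ≤ M * (σ ^ 2 * (ρ * s ^ 2)) :=
    (mul_le_mul hM (pow_le_pow_left₀ hsa hsa_le 2) (sq_nonneg _)
      ((sq_nonneg _).trans hM)).trans_eq (by ring)
  have hM_nonneg : 0 ≤ M * σ ^ 2 := by
    by_contra! hneg
    nlinarith [sq_nonneg (16 * (lam / κ) + a * √ρ)]
  rw [← mul_effSparsity_sqrt hρ, ← hs_def]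
  refine ⟨by linarith, ?_, ?_⟩
  · linarith [mul_le_mul_of_nonneg_left hscale hκ.le]
  · linarith [mul_le_mul_of_nonneg_left
      (mul_effSparsity_sqrt_sq_le (q₁ := q₁) (q₂ := q₂) (R₁ := R₁) (R₂ := R₂) hρ) hM_nonneg]

-- The truncation level is `η = a √ρ`, where the factor `a` is chosen so large that the effective
-- sparsity at this level meets the smallness condition of the oracle inequality.
theorem exists_error_bounds {κ T σ₀ : ℝ} (hκ : 0 < κ) (hT : 0 ≤ T) (hσ₀ : 0 < σ₀)
    (hq₁ : q₁ ∈ Set.Ioc 0 1) (hq₂ : q₂ ∈ Set.Ioc 0 1) (C₁ K : ℝ) :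
    ∃ M : ℝ, 0 < M ∧ ∀ {N n : ℕ} {m : Type*} [Fintype m] {D : Matrix m (Fin n) ℝ}
      {X : Matrix (Fin N) (Fin n) ℝ} {ε : Fin N → ℝ} {βs b : Fin n → ℝ}
      {lamg lam ρ σ R₁ R₂ : ℝ}, 0 < N → 0 < ρ → σ₀ ≤ σ → 0 < lam → lam ≤ C₁ * (σ * √ρ) →
      IsAdmissiblePenalty D lamg lam →
      ∑ i, |D.mulVec βs i| ^ q₁ ≤ R₁ → ∑ j, |βs j| ^ q₂ ≤ R₂ →
      R₁ * ρ ^ (1 - q₁ / 2) + R₂ * ρ ^ (1 - q₂ / 2) ≤ K →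
      IsMinOn (genLassoObjective D lamg lam X (X.mulVec βs + ε)) Set.univ b →
      RestrictedEigenvalue X κ (T * ρ) → (∀ j, |∑ i, X i j * ε i| ≤ N * (lam / 4)) →
      ∑ j, (b - βs) j ^ 2
          ≤ M * (σ ^ 2 * (R₁ * ρ ^ (1 - q₁ / 2) + R₂ * ρ ^ (1 - q₂ / 2))) ∧
        1 / (N : ℝ) * ∑ i, X.mulVec (b - βs) i ^ 2
          ≤ M * (σ ^ 2 * (R₁ * ρ ^ (1 - q₁ / 2) + R₂ * ρ ^ (1 - q₂ / 2))) ∧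
        (∑ j, |(b - βs) j|) ^ 2
          ≤ M * (σ ^ 2 * (R₁ ^ 2 * ρ ^ (1 - q₁) + R₂ ^ 2 * ρ ^ (1 - q₂))) := by
  obtain ⟨a, ha, haκ⟩ :=
    exists_one_le_rpow_neg_mul_le (x := 128 * T * K) (lt_min hq₁.1 hq₂.1) hκ
  have : 0 < a := zero_lt_one.trans_le ha
  set M₀ := (16 * (|C₁| / κ) + a / σ₀) ^ 2
  have hM₀ : 0 < M₀ := by positivity
  refine ⟨(48 + κ) * M₀, by positivity, ?_⟩
  intro N n m _ D X ε βs b lamg lam ρ σ R₁ R₂ hN hρ hσ hlam hlam_le hD hR₁ hR₂ hK hb hX hnoise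
  have hR₁_nonneg : 0 ≤ R₁ := le_trans (by positivity) hR₁
  have hR₂_nonneg : 0 ≤ R₂ := le_trans (by positivity) hR₂
  have hsmall : 128 * (T * ρ) * effSparsity q₁ q₂ R₁ R₂ (a * √ρ) ≤ κ :=
    calc 128 * (T * ρ) * effSparsity q₁ q₂ R₁ R₂ (a * √ρ)
        ≤ 128 * (T * ρ) * (a ^ (-min q₁ q₂) * effSparsity q₁ q₂ R₁ R₂ √ρ) := by
          gcongr
          exact effSparsity_mul_le hR₁_nonneg hR₂_nonneg ha (Real.sqrt_nonneg ρ)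
      _ = a ^ (-min q₁ q₂) * (128 * T * (ρ * effSparsity q₁ q₂ R₁ R₂ √ρ)) := by ring
      _ ≤ a ^ (-min q₁ q₂) * (128 * T * K) := by rw [mul_effSparsity_sqrt hρ]; gcongr
      _ ≤ κ := haκ
  have hscale : (16 * (lam / κ) + a * √ρ) ^ 2 ≤ M₀ * (ρ * σ ^ 2) :=
    calc (16 * (lam / κ) + a * √ρ) ^ 2
        ≤ (16 * (|C₁| * (σ * √ρ) / κ) + a * (σ / σ₀ * √ρ)) ^ 2 := by
          have hσ_pos : 0 < σ := hσ₀.trans_le hσ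
          gcongr
          · exact hlam_le.trans (by gcongr; exact le_abs_self C₁)
          · exact le_mul_of_one_le_left (Real.sqrt_nonneg ρ) ((one_le_div hσ₀).2 hσ)
      _ = M₀ * (√ρ ^ 2 * σ ^ 2) := by ring
      _ = M₀ * (ρ * σ ^ 2) := by rw [Real.sq_sqrt hρ.le]
  obtain ⟨hd, hp, hw⟩ := error_bounds_rate hN hD hlam hb hnoise hq₁ hq₂ hR₁ hR₂ hκ
    (by positivity) hX ha hρ hsmall hscale
  have hκM₀ : 0 < κ * M₀ := by positivity
  refine ⟨hd.trans ?_, hp.trans ?_, hw.trans ?_⟩ <;> gcongr <;> linarith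

end Rates

section SquareExponentialMoment

open scoped NNReal

variable {Ω : Type*} [MeasurableSpace Ω] {P : Measure Ω} {Y : Ω → ℝ} {c : ℝ≥0}

lemma lintegral_exp_neg_mul_sub_sq {b : ℝ} (hb : 0 < b) (a : ℝ) :
    ∫⁻ s : ℝ, ENNReal.ofReal (Real.exp (-b * (s - a) ^ 2)) = ENNReal.ofReal √(Real.pi / b) := by
  rw [lintegral_sub_right_eq_self (fun s : ℝ => ENNReal.ofReal (Real.exp (-b * s ^ 2))) a,
    ← ofReal_integral_eq_lintegral_ofReal (integrable_exp_neg_mul_sq hb)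
      (ae_of_all _ fun _ => (Real.exp_pos _).le), integral_gaussian]

lemma lintegral_exp_mul_sub_mul_sq {b : ℝ} (hb : 0 < b) (y : ℝ) :
    ∫⁻ s : ℝ, ENNReal.ofReal (Real.exp (s * y - b * s ^ 2))
      = ENNReal.ofReal √(Real.pi / b) * ENNReal.ofReal (Real.exp (y ^ 2 / (4 * b))) := by
  rw [← lintegral_exp_neg_mul_sub_sq hb (y / (2 * b)),
    ← lintegral_mul_const' _ _ ENNReal.ofReal_ne_top]
  refine lintegral_congr fun s => ?_
  rw [← ENNReal.ofReal_mul (Real.exp_pos _).le, ← Real.exp_add]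
  congr 2
  field_simp
  ring

lemma lintegral_exp_mul_sub_le (h : HasSubgaussianMGF Y c P) (b s : ℝ) :
    ∫⁻ ω, ENNReal.ofReal (Real.exp (s * Y ω - b * s ^ 2)) ∂P
      ≤ ENNReal.ofReal (Real.exp (-(b - c / 2) * s ^ 2)) := by
  simp only [Real.exp_sub]
  rw [← ofReal_integral_eq_lintegral_ofReal ((h.integrable_exp_mul s).div_const _)
    (ae_of_all _ fun _ => by positivity), integral_div]
  refine ENNReal.ofReal_le_ofReal ((div_le_iff₀ (Real.exp_pos _)).2 ?_)
  rw [← Real.exp_add]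
  exact (h.mgf_le s).trans_eq (congrArg Real.exp (by ring))

-- `exp (y² / (4c))` is a Gaussian mixture of the exponentials `exp (s y)`, so the bound on the
-- moment generating function can be integrated over `s`.
lemma lintegral_exp_sq_div_le [SFinite P] (h : HasSubgaussianMGF Y c P) (hc : 0 < c) :
    ∫⁻ ω, ENNReal.ofReal (Real.exp (Y ω ^ 2 / (4 * c))) ∂P ≤ 2 := by
  have hc' : (0 : ℝ) < c := hc
  have hY := h.aemeasurable
  have hpi : 0 < √(Real.pi / c) := Real.sqrt_pos.2 (by positivity)
  have hmix : ENNReal.ofReal √(Real.pi / c)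
      * ∫⁻ ω, ENNReal.ofReal (Real.exp (Y ω ^ 2 / (4 * c))) ∂P
      ≤ ENNReal.ofReal √(Real.pi / (c / 2)) := by
    rw [← lintegral_const_mul' _ _ ENNReal.ofReal_ne_top]
    simp only [← lintegral_exp_mul_sub_mul_sq hc']
    rw [lintegral_lintegral_swap (by fun_prop),
      ← lintegral_exp_neg_mul_sub_sq (half_pos hc') 0]
    refine lintegral_mono fun s => (lintegral_exp_mul_sub_le h c s).trans_eq ?_
    rw [sub_zero, sub_half]
  have hsqrt : √(Real.pi / (c / 2)) ≤ √(Real.pi / c) * 2 := by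
    rw [Real.sqrt_le_left (by positivity), mul_pow, Real.sq_sqrt (by positivity),
      div_div_eq_mul_div, mul_div_right_comm]
    gcongr
    norm_num
  refine (ENNReal.mul_le_mul_iff_right (ENNReal.ofReal_pos.2 hpi).ne'
    ENNReal.ofReal_ne_top).1 (hmix.trans ?_)
  rw [← ENNReal.ofReal_ofNat 2, ← ENNReal.ofReal_mul hpi.le]
  exact ENNReal.ofReal_le_ofReal hsqrt

lemma integrable_exp_sq_div [SFinite P] (h : HasSubgaussianMGF Y c P) (hc : 0 < c) :
    Integrable (fun ω => Real.exp (Y ω ^ 2 / (4 * c))) P := by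
  have hY := h.aemeasurable
  refine ⟨(by fun_prop : AEMeasurable _ P).aestronglyMeasurable, ?_⟩
  rw [hasFiniteIntegral_iff_ofReal (ae_of_all _ fun _ => (Real.exp_pos _).le)]
  exact (lintegral_exp_sq_div_le h hc).trans_lt ENNReal.ofNat_lt_top

lemma integral_exp_sq_div_le [SFinite P] (h : HasSubgaussianMGF Y c P) (hc : 0 < c) :
    ∫ ω, Real.exp (Y ω ^ 2 / (4 * c)) ∂P ≤ 2 := by
  rw [← ENNReal.ofReal_le_ofReal_iff (by norm_num), ENNReal.ofReal_ofNat,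
    ofReal_integral_eq_lintegral_ofReal (integrable_exp_sq_div h hc)
      (ae_of_all _ fun _ => (Real.exp_pos _).le)]
  exact lintegral_exp_sq_div_le h hc

lemma sq_le_mul_exp {x : ℝ} (hx : 0 ≤ x) : x ^ 2 ≤ 2 * Real.exp x := by
  linarith [Real.quadratic_le_exp_of_nonneg hx]

lemma integral_pow_four_le [SFinite P] (h : HasSubgaussianMGF Y c P) (hc : 0 < c) :
    ∫ ω, Y ω ^ 4 ∂P ≤ 64 * c ^ 2 := by
  have : (0 : ℝ) < c := hc
  have hpow (y : ℝ) : y ^ 4 ≤ 32 * c ^ 2 * Real.exp (y ^ 2 / (4 * c)) := calc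
    y ^ 4 = 16 * c ^ 2 * (y ^ 2 / (4 * c)) ^ 2 := by field_simp; ring
    _ ≤ 16 * c ^ 2 * (2 * Real.exp (y ^ 2 / (4 * c))) := by
      gcongr
      exact sq_le_mul_exp (by positivity)
    _ = 32 * c ^ 2 * Real.exp (y ^ 2 / (4 * c)) := by ring
  calc
    ∫ ω, Y ω ^ 4 ∂P ≤ ∫ ω, 32 * c ^ 2 * Real.exp (Y ω ^ 2 / (4 * c)) ∂P :=
      integral_mono_of_nonneg (ae_of_all _ fun _ => by positivity)
        ((integrable_exp_sq_div h hc).const_mul _) (ae_of_all _ fun ω => hpow (Y ω))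
    _ ≤ 32 * c ^ 2 * 2 := by
      rw [integral_const_mul]
      gcongr
      exact integral_exp_sq_div_le h hc
    _ = 64 * c ^ 2 := by ring

lemma memLp_sq (h : HasSubgaussianMGF Y c P) : MemLp (fun ω => Y ω ^ 2) 2 P := by
  have hmem := (h.memLp 4).norm_rpow_div 2
  have hexp : (4 : ENNReal) / 2 = 2 := by
    rw [eq_comm, ENNReal.eq_div_iff two_ne_zero ENNReal.ofNat_ne_top]
    norm_num
  simpa [hexp] using hmem

end SquareExponentialMoment

section SumTails

open scoped NNReal

variable {Ω ι : Type*} [MeasurableSpace Ω] {P : Measure Ω} [Fintype ι]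

lemma exp_neg_le_quadratic {x : ℝ} (hx : 0 ≤ x) : Real.exp (-x) ≤ 1 - x + x ^ 2 / 2 := by
  have hpos : 0 < 1 - x + x ^ 2 / 2 := by nlinarith [sq_nonneg (x - 1)]
  rw [Real.exp_neg, inv_le_comm₀ (Real.exp_pos _) hpos]
  refine le_trans ?_ (Real.quadratic_le_exp_of_nonneg hx)
  rw [inv_le_iff_one_le_mul₀ hpos]
  nlinarith [sq_nonneg (x ^ 2)]

lemma mgf_neg_le_of_nonneg [IsProbabilityMeasure P] {Z : Ω → ℝ} (hZ : 0 ≤ Z) (hL : MemLp Z 2 P)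
    {t : ℝ} (ht : 0 ≤ t) :
    mgf Z P (-t) ≤ Real.exp (-t * ∫ ω, Z ω ∂P + t ^ 2 / 2 * ∫ ω, Z ω ^ 2 ∂P) := by
  have hint : Integrable Z P := hL.integrable one_le_two
  have hlin : Integrable (fun ω => 1 - t * Z ω) P := (integrable_const _).sub (hint.const_mul t)
  have hquad : Integrable (fun ω => t ^ 2 / 2 * Z ω ^ 2) P := hL.integrable_sq.const_mul _
  calc
    mgf Z P (-t) ≤ ∫ ω, (1 - t * Z ω + t ^ 2 / 2 * Z ω ^ 2) ∂P := by
      refine integral_mono_of_nonneg (ae_of_all _ fun _ => (Real.exp_pos _).le)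
        (hlin.add hquad) (ae_of_all _ fun ω => ?_)
      have := exp_neg_le_quadratic (mul_nonneg ht (hZ ω))
      simp only [neg_mul]
      linarith
    _ = (-t * ∫ ω, Z ω ∂P + t ^ 2 / 2 * ∫ ω, Z ω ^ 2 ∂P) + 1 := by
      rw [integral_add hlin hquad, integral_sub (integrable_const _) (hint.const_mul t),
        integral_const_mul, integral_const_mul]
      simp only [integral_const, probReal_univ, one_smul]
      ring
    _ ≤ _ := Real.add_one_le_exp _

lemma measureReal_sum_le_half_mean_le {Z : ι → Ω → ℝ} (hind : iIndepFun Z P) (hZ : 0 ≤ Z)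
    (hL : ∀ i, MemLp (Z i) 2 P) {m B : ℝ} (hm : 0 ≤ m) (hB : 0 < B)
    (hmean : ∀ i, m ≤ ∫ ω, Z i ω ∂P) (hsq : ∀ i, ∫ ω, Z i ω ^ 2 ∂P ≤ B) :
    P.real {ω | ∑ i, Z i ω ≤ Fintype.card ι * (m / 2)}
      ≤ Real.exp (-(m ^ 2 / (8 * B) * Fintype.card ι)) := by
  have := hind.isProbabilityMeasure
  have hae (i) : AEMeasurable (Z i) P := (hL i).aestronglyMeasurable.aemeasurable
  -- the minimizer of the exponent `-t m / 2 + t² B / 2`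
  set t := m / (2 * B)
  have ht : 0 ≤ t := by positivity
  have hint : Integrable (fun ω => Real.exp (-t * (∑ i, Z i) ω)) P := by
    refine Integrable.of_bound (by fun_prop) 1 (ae_of_all _ fun ω => ?_)
    rw [Real.norm_of_nonneg (Real.exp_pos _).le, Real.exp_le_one_iff, neg_mul,
      Finset.sum_apply, neg_nonpos]
    exact mul_nonneg ht (Finset.sum_nonneg fun i _ => hZ i ω)
  have hmgf (i) : mgf (Z i) P (-t) ≤ Real.exp (-t * m + t ^ 2 / 2 * B) := by
    refine (mgf_neg_le_of_nonneg (hZ i) (hL i) ht).trans (Real.exp_le_exp.2 ?_)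
    simp only [neg_mul]
    gcongr
    exacts [hmean i, hsq i]
  calc
    P.real {ω | ∑ i, Z i ω ≤ Fintype.card ι * (m / 2)}
        ≤ Real.exp (t * (Fintype.card ι * (m / 2))) * ∏ i, mgf (Z i) P (-t) := by
      simpa [hind.mgf_sum₀ hae] using
        measure_le_le_exp_mul_mgf (Fintype.card ι * (m / 2)) (neg_nonpos.2 ht) hint
    _ ≤ Real.exp (t * (Fintype.card ι * (m / 2)))
          * ∏ _i : ι, Real.exp (-t * m + t ^ 2 / 2 * B) := by
      gcongr with i
      exacts [fun i _ => mgf_nonneg, hmgf i]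
    _ = Real.exp (-(m ^ 2 / (8 * B) * Fintype.card ι)) := by
      rw [Finset.prod_const, Finset.card_univ, ← Real.exp_nat_mul, ← Real.exp_add]
      congr 1
      simp only [t]
      field_simp
      ring

variable {W : ι → Ω → ℝ} {c : ℝ≥0}

lemma measureReal_le_sum_sq_le (hind : iIndepFun W P) (hW : ∀ i, Measurable (W i)) (hc : 0 < c)
    (h : ∀ i, HasSubgaussianMGF (W i) c P) :
    P.real {ω | 8 * c * Fintype.card ι ≤ ∑ i, W i ω ^ 2} ≤ Real.exp (-Fintype.card ι) := by
  have := hind.isProbabilityMeasure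
  have : (0 : ℝ) < c := hc
  have hind_sq : iIndepFun (fun i ω => W i ω ^ 2) P :=
    hind.comp (fun _ x => x ^ 2) fun _ => by fun_prop
  have hexp (i ω) : (4 * c : ℝ)⁻¹ * W i ω ^ 2 = W i ω ^ 2 / (4 * c) := by ring
  have hint : Integrable (fun ω => Real.exp ((4 * c : ℝ)⁻¹ * (∑ i, fun ω => W i ω ^ 2) ω)) P :=
    hind_sq.integrable_exp_mul_sum (fun i => by fun_prop) fun i _ => by
      simpa only [hexp] using integrable_exp_sq_div (h i) hc
  have hmgf (i) : mgf (fun ω => W i ω ^ 2) P (4 * c : ℝ)⁻¹ ≤ Real.exp 1 := by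
    simp only [mgf, hexp]
    linarith [integral_exp_sq_div_le (h i) hc, Real.add_one_le_exp (1 : ℝ)]
  calc
    P.real {ω | 8 * c * Fintype.card ι ≤ ∑ i, W i ω ^ 2}
        ≤ Real.exp (-(4 * c : ℝ)⁻¹ * (8 * c * Fintype.card ι))
          * ∏ i, mgf (fun ω => W i ω ^ 2) P (4 * c : ℝ)⁻¹ := by
      have := measure_ge_le_exp_mul_mgf (8 * c * Fintype.card ι) (by positivity) hint
      rwa [hind_sq.mgf_sum fun i => by fun_prop, Finset.sum_fn] at this
    _ ≤ Real.exp (-(4 * c : ℝ)⁻¹ * (8 * c * Fintype.card ι)) * ∏ _i : ι, Real.exp 1 := by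
      gcongr with i
      exacts [fun i _ => mgf_nonneg, hmgf i]
    _ = Real.exp (-Fintype.card ι) := by
      rw [Finset.prod_const, Finset.card_univ, ← Real.exp_nat_mul, ← Real.exp_add]
      congr 1
      field_simp
      ring

lemma measureReal_sum_sq_le_half_mean_le (hind : iIndepFun W P) (hc : 0 < c)
    (h : ∀ i, HasSubgaussianMGF (W i) c P) {m : ℝ} (hm : 0 ≤ m)
    (hmean : ∀ i, m ≤ ∫ ω, W i ω ^ 2 ∂P) :
    P.real {ω | ∑ i, W i ω ^ 2 ≤ Fintype.card ι * (m / 2)}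
      ≤ Real.exp (-(m ^ 2 / (512 * c ^ 2) * Fintype.card ι)) := by
  have := hind.isProbabilityMeasure
  have : (0 : ℝ) < c := hc
  have key := measureReal_sum_le_half_mean_le (Z := fun i ω => W i ω ^ 2) (B := 64 * c ^ 2)
    (hind.comp (fun _ x => x ^ 2) fun _ => by fun_prop) (fun i ω => sq_nonneg _)
    (fun i => memLp_sq (h i)) hm (by positivity) hmean
    fun i => by simpa only [← pow_mul] using integral_pow_four_le (h i) hc
  rwa [← mul_assoc, show (8 * 64 : ℝ) = 512 by norm_num] at key

lemma hasSubgaussianMGF_mono {Y : Ω → ℝ} {c' : ℝ≥0} (h : HasSubgaussianMGF Y c P)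
    (hc : c ≤ c') : HasSubgaussianMGF Y c' P :=
  ⟨h.integrable_exp_mul, fun t => (h.mgf_le t).trans (by gcongr)⟩

lemma measureReal_lt_abs_le [IsFiniteMeasure P] {Y : Ω → ℝ} (h : HasSubgaussianMGF Y c P) {u : ℝ}
    (hu : 0 ≤ u) :
    P.real {ω | u < |Y ω|} ≤ 2 * Real.exp (-u ^ 2 / (2 * c)) := by
  calc
    P.real {ω | u < |Y ω|} ≤ P.real ({ω | u ≤ Y ω} ∪ {ω | u ≤ (-Y) ω}) :=
      measureReal_mono fun ω hω => (lt_abs.1 hω).imp le_of_lt fun hY => show u ≤ -Y ω from hY.le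
    _ ≤ P.real {ω | u ≤ Y ω} + P.real {ω | u ≤ (-Y) ω} := measureReal_union_le _ _
    _ ≤ 2 * Real.exp (-u ^ 2 / (2 * c)) := by
      linarith [h.measure_ge_le hu, h.neg.measure_ge_le hu]

lemma hasSubgaussianMGF_sum_mul (hind : iIndepFun W P) (h : ∀ i, HasSubgaussianMGF (W i) c P)
    (e : ι → ℝ) {V : ℝ≥0} (hV : ∑ i, e i ^ 2 ≤ V) :
    HasSubgaussianMGF (fun ω => ∑ i, e i * W i ω) (V * c) P := by
  have hind' : iIndepFun (fun i ω => e i * W i ω) P :=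
    hind.comp (fun i x => e i * x) fun _ => by fun_prop
  refine hasSubgaussianMGF_mono (HasSubgaussianMGF.sum_of_iIndepFun hind' (s := Finset.univ)
    fun i _ => (h i).const_mul (e i)) ?_
  rw [← NNReal.coe_le_coe, NNReal.coe_sum]
  change ∑ i, e i ^ 2 * (c : ℝ) ≤ V * c
  rw [← Finset.sum_mul]
  gcongr

lemma measure_sum_sq_le_and_lt_abs_sum_mul_le (hind : iIndepFun W P)
    (hW : ∀ i, Measurable (W i)) (h : ∀ i, HasSubgaussianMGF (W i) c P) {ε : Ω → ι → ℝ}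
    (hε : Measurable ε) (hWε : IndepFun (fun ω i => W i ω) ε P) (V : ℝ≥0) {u : ℝ} (hu : 0 ≤ u) :
    P {ω | ∑ i, ε ω i ^ 2 ≤ V ∧ u < |∑ i, ε ω i * W i ω|}
      ≤ ENNReal.ofReal (2 * Real.exp (-u ^ 2 / (2 * (V * c)))) := by
  have := hind.isProbabilityMeasure
  have := Measure.isProbabilityMeasure_map (μ := P) hε.aemeasurable
  have hW' : Measurable fun ω i => W i ω := measurable_pi_lambda _ hW
  set B : Set ((ι → ℝ) × (ι → ℝ)) := {p | ∑ i, p.1 i ^ 2 ≤ V ∧ u < |∑ i, p.1 i * p.2 i|}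
  have hB : MeasurableSet B := by
    have hsq : Measurable fun p : (ι → ℝ) × (ι → ℝ) => ∑ i, p.1 i ^ 2 := by fun_prop
    have hmul : Measurable fun p : (ι → ℝ) × (ι → ℝ) => |∑ i, p.1 i * p.2 i| := by fun_prop
    exact (measurableSet_le hsq measurable_const).inter (measurableSet_lt measurable_const hmul)
  have hslice (e : ι → ℝ) : (P.map fun ω i => W i ω) (Prod.mk e ⁻¹' B)
      ≤ ENNReal.ofReal (2 * Real.exp (-u ^ 2 / (2 * (V * c)))) := by
    rw [Measure.map_apply hW' (measurable_prodMk_left hB)]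
    by_cases he : ∑ i, e i ^ 2 ≤ V
    · rw [ENNReal.le_ofReal_iff_toReal_le (measure_ne_top _ _) (by positivity)]
      refine (measureReal_mono fun ω hω => ?_).trans
        (measureReal_lt_abs_le (hasSubgaussianMGF_sum_mul hind h e he) hu)
      exact hω.2
    · have hempty : (fun ω i => W i ω) ⁻¹' (Prod.mk e ⁻¹' B) = ∅ :=
        Set.eq_empty_of_forall_notMem fun ω hω => he hω.1
      simp only [hempty, measure_empty, zero_le]
  calc
    P {ω | ∑ i, ε ω i ^ 2 ≤ V ∧ u < |∑ i, ε ω i * W i ω|}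
        = (P.map fun ω => (ε ω, fun i => W i ω)) B := by
      rw [Measure.map_apply (hε.prodMk hW') hB]
      rfl
    _ = ∫⁻ e, (P.map fun ω i => W i ω) (Prod.mk e ⁻¹' B) ∂(P.map ε) := by
      rw [(indepFun_iff_map_prod_eq_prod_map_map hε.aemeasurable hW'.aemeasurable).1 hWε.symm,
        Measure.prod_apply hB]
    _ ≤ ∫⁻ _, ENNReal.ofReal (2 * Real.exp (-u ^ 2 / (2 * (V * c)))) ∂(P.map ε) :=
      lintegral_mono hslice
    _ = ENNReal.ofReal (2 * Real.exp (-u ^ 2 / (2 * (V * c)))) := by simp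

end SumTails

section Sparsification

variable {ι E : Type*} [Fintype ι] [AddCommGroup E] [Module ℝ E]

lemma exists_le_weighted_sum {p g : ι → ℝ} (hp : ∀ i, 0 ≤ p i) (hp₁ : ∑ i, p i = 1) :
    ∃ i, g i ≤ ∑ i, p i * g i := by
  obtain ⟨i, -, hi⟩ := (concaveOn_id convex_univ).exists_le_of_centerMass
    (t := Finset.univ) (w := p) (p := g) (fun i _ => hp i) (by linarith) fun _ _ => Set.mem_univ _
  rw [Finset.centerMass_eq_of_sum_1 _ _ hp₁] at hi
  exact ⟨i, hi⟩

-- Maurey's argument, derandomized: the right-hand side is the expectation of the left-hand side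
-- for `f` drawn coordinatewise from `p`, and the entries of `f` are fixed one at a time.
lemma exists_bilin_add_sum_le {B : LinearMap.BilinForm ℝ E} (hB : B.IsSymm) {p : ι → ℝ}
    (hp : ∀ i, 0 ≤ p i) (hp₁ : ∑ i, p i = 1) (z : ι → E) (s : ℕ) (y : E) :
    ∃ f : Fin s → ι, B (y + ∑ i, z (f i)) (y + ∑ i, z (f i))
      ≤ B y y + 2 * s * B y (∑ i, p i • z i)
        + s * (s - 1) * B (∑ i, p i • z i) (∑ i, p i • z i) + s * ∑ i, p i * B (z i) (z i) := by
  set m := ∑ i, p i • z i with hm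
  have hmean (x : E) : ∑ i, p i * B x (z i) = B x m := by simp [hm, map_sum]
  induction s generalizing y with
  | zero => exact ⟨Fin.elim0, by simp⟩
  | succ s ih =>
    have haverage : ∑ i, p i * (B (y + z i) (y + z i) + 2 * s * B (y + z i) m)
        = B y y + 2 * B y m + ∑ i, p i * B (z i) (z i) + 2 * s * (B y m + B m m) := by
      have hexpand (i) : p i * (B (y + z i) (y + z i) + 2 * s * B (y + z i) m)
          = p i * B y y + 2 * (p i * B y (z i)) + p i * B (z i) (z i)
            + 2 * s * (p i * B y m + p i * B m (z i)) := by
        simp only [map_add, LinearMap.add_apply, hB.eq (z i) y, hB.eq (z i) m]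
        ring
      simp only [hexpand, Finset.sum_add_distrib, ← Finset.mul_sum, ← Finset.sum_mul, hp₁, hmean,
        one_mul]
    obtain ⟨i, hi⟩ := exists_le_weighted_sum
      (g := fun i => B (y + z i) (y + z i) + 2 * s * B (y + z i) m) hp hp₁
    obtain ⟨f, hf⟩ := ih (y + z i)
    refine ⟨Fin.cons i f, ?_⟩
    simp only [Fin.sum_univ_succ, Fin.cons_zero, Fin.cons_succ, ← add_assoc]
    push_cast
    linarith

lemma sub_one_mul_bilin_add_nonneg {B : LinearMap.BilinForm ℝ E} (hB : B.IsSymm) {p : ι → ℝ}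
    (hp : ∀ i, 0 ≤ p i) (hp₁ : ∑ i, p i = 1) {z : ι → E} {s : ℕ} (hs : 0 < s)
    (hsum : ∀ f : Fin s → ι, 0 ≤ B (∑ i, z (f i)) (∑ i, z (f i))) {C : ℝ}
    (hC : ∀ i, B (z i) (z i) ≤ C) :
    0 ≤ (s - 1) * B (∑ i, p i • z i) (∑ i, p i • z i) + C := by
  obtain ⟨f, hf⟩ := exists_bilin_add_sum_le hB hp hp₁ z s 0
  simp only [zero_add, map_zero, LinearMap.zero_apply, mul_zero] at hf
  have hmean : ∑ i, p i * B (z i) (z i) ≤ C := calc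
    ∑ i, p i * B (z i) (z i) ≤ ∑ i, p i * C :=
      Finset.sum_le_sum fun i _ => mul_le_mul_of_nonneg_left (hC i) (hp i)
    _ = C := by rw [← Finset.sum_mul, hp₁, one_mul]
  have hs' : (0 : ℝ) < s := Nat.cast_pos.2 hs
  refine nonneg_of_mul_nonneg_right (a := (s : ℝ)) ?_ hs'
  nlinarith [hsum f, mul_le_mul_of_nonneg_left hmean hs'.le]

end Sparsification

section SignedBasis

variable {N n s : ℕ}

/-- The signed standard basis vector `± e_j`; these are the extreme points of the `ℓ₁` unit
ball. The sign is `+` for `true`. -/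
def signedBasis (a : Fin n × Bool) : Fin n → ℝ :=
  Pi.single a.1 (if a.2 then 1 else -1)

lemma sum_abs_smul_signedBasis (v : Fin n → ℝ) :
    ∑ j, |v j| • signedBasis (j, decide (0 ≤ v j)) = v := by
  ext a
  simp only [Finset.sum_apply, Pi.smul_apply, signedBasis, Pi.single_apply, smul_eq_mul,
    mul_ite, mul_zero, Finset.sum_ite_eq, Finset.mem_univ, if_true, decide_eq_true_eq]
  split_ifs with hv
  · rw [abs_of_nonneg hv, mul_one]
  · rw [abs_of_neg (not_le.1 hv), neg_mul_neg, mul_one]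

lemma sub_one_mul_bilin_add_sum_abs_sq_nonneg {B : LinearMap.BilinForm ℝ (Fin n → ℝ)}
    (hB : B.IsSymm) (hs : 0 < s)
    (hsum : ∀ f : Fin s → Fin n × Bool,
      0 ≤ B (∑ i, signedBasis (f i)) (∑ i, signedBasis (f i)))
    {C : ℝ} (hC : ∀ a, B (signedBasis a) (signedBasis a) ≤ C) (v : Fin n → ℝ) :
    0 ≤ (s - 1) * B v v + C * (∑ j, |v j|) ^ 2 := by
  rcases (Finset.sum_nonneg fun j _ => abs_nonneg (v j) : 0 ≤ ∑ j, |v j|).eq_or_lt with hℓ | hℓ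
  · have hv : v = 0 := by
      rw [← sum_abs_smul_signedBasis v]
      refine Finset.sum_eq_zero fun j hj => ?_
      rw [(Finset.sum_eq_zero_iff_of_nonneg fun j _ => abs_nonneg (v j)).1 hℓ.symm j hj, zero_smul]
    simp [hv]
  · set ℓ := ∑ j, |v j|
    have hp₁ : ∑ j, |v j| / ℓ = 1 := by rw [← Finset.sum_div, div_self hℓ.ne']
    have hmean : ∑ j, (|v j| / ℓ) • signedBasis (j, decide (0 ≤ v j)) = ℓ⁻¹ • v := by
      conv_rhs => rw [← sum_abs_smul_signedBasis v, Finset.smul_sum]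
      simp only [smul_smul, div_eq_inv_mul]
    have key := sub_one_mul_bilin_add_nonneg hB (p := fun j => |v j| / ℓ)
      (fun j => by positivity) hp₁ hs (fun f => hsum fun i => (f i, decide (0 ≤ v (f i))))
      fun j => hC (j, decide (0 ≤ v j))
    rw [hmean] at key
    simp only [map_smul, LinearMap.smul_apply, smul_eq_mul] at key
    have hscale : (s - 1) * B v v + C * ℓ ^ 2
        = ((s - 1) * (ℓ⁻¹ * (ℓ⁻¹ * B v v)) + C) * ℓ ^ 2 := by
      field_simp
    exact hscale ▸ mul_nonneg key (sq_nonneg ℓ)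

/-- The symmetric bilinear form of `N⁻¹ Xᵀ X - κ I`, which measures by how much the empirical
Gram matrix exceeds the curvature `κ`. -/
noncomputable def gramExcess (X : Matrix (Fin N) (Fin n) ℝ) (κ : ℝ) :
    LinearMap.BilinForm ℝ (Fin n → ℝ) :=
  Matrix.toBilin' ((1 / (N : ℝ)) • (X.transpose * X) - κ • 1)

lemma gramExcess_isSymm (X : Matrix (Fin N) (Fin n) ℝ) (κ : ℝ) : (gramExcess X κ).IsSymm :=
  Matrix.isSymm_toBilin'_iff_isSymm.2 <| by simp [Matrix.IsSymm, Matrix.transpose_mul]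

lemma gramExcess_self (X : Matrix (Fin N) (Fin n) ℝ) (κ : ℝ) (v : Fin n → ℝ) :
    gramExcess X κ v v = 1 / (N : ℝ) * ∑ i, X.mulVec v i ^ 2 - κ * ∑ j, v j ^ 2 := by
  have hgram : v ⬝ᵥ (X.transpose * X).mulVec v = X.mulVec v ⬝ᵥ X.mulVec v := by
    rw [← Matrix.mulVec_mulVec, Matrix.dotProduct_mulVec, Matrix.vecMul_transpose]
  rw [gramExcess, Matrix.toBilin'_apply', Matrix.sub_mulVec, dotProduct_sub, Matrix.smul_mulVec,
    Matrix.smul_mulVec, Matrix.one_mulVec, dotProduct_smul, dotProduct_smul, hgram]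
  simp only [dotProduct, smul_eq_mul, sq]

lemma sum_sq_mulVec_signedBasis (X : Matrix (Fin N) (Fin n) ℝ) (a : Fin n × Bool) :
    ∑ i, X.mulVec (signedBasis a) i ^ 2 = ∑ i, X i a.1 ^ 2 := by
  refine Finset.sum_congr rfl fun i _ => ?_
  simp only [signedBasis, Matrix.mulVec_single, Pi.smul_apply, Matrix.col_apply]
  split_ifs <;> simp

lemma restrictedEigenvalue_of_sparse {X : Matrix (Fin N) (Fin n) ℝ} {κ C : ℝ} (hκ : 0 ≤ κ)
    (hs : 2 ≤ s)
    (hsparse : ∀ f : Fin s → Fin n × Bool, κ * ∑ j, (∑ i, signedBasis (f i)) j ^ 2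
      ≤ 1 / (N : ℝ) * ∑ i, X.mulVec (∑ i, signedBasis (f i)) i ^ 2)
    (hcol : ∀ j, 1 / (N : ℝ) * ∑ i, X i j ^ 2 ≤ C) :
    RestrictedEigenvalue X κ (C / (s - 1)) := by
  intro v
  have hs' : (0 : ℝ) < s - 1 := by
    have : (2 : ℝ) ≤ s := by exact_mod_cast hs
    linarith
  have hvertex (a : Fin n × Bool) : gramExcess X κ (signedBasis a) (signedBasis a) ≤ C := by
    rw [gramExcess_self, sum_sq_mulVec_signedBasis]
    exact (sub_le_self _ (by positivity)).trans (hcol a.1)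
  have key := sub_one_mul_bilin_add_sum_abs_sq_nonneg (gramExcess_isSymm X κ) (s := s) (by lia)
    (fun f => by rw [gramExcess_self]; exact sub_nonneg.2 (hsparse f)) hvertex v
  rw [gramExcess_self] at key
  refine le_of_mul_le_mul_left ?_ hs'
  rw [mul_add, ← mul_assoc _ (C / _), mul_div_cancel₀ _ hs'.ne']
  linarith

end SignedBasis

section SecondMoments

variable {Ω : Type*} [MeasurableSpace Ω] {P : Measure Ω} {n : ℕ}

lemma mul_sum_sq_le_dotProduct_mulVec {S : Matrix (Fin n) (Fin n) ℝ} (hS : S.IsHermitian) {c : ℝ}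
    (hc : ∀ μ ∈ spectrum ℝ S, c ≤ μ) (u : Fin n → ℝ) : c * ∑ j, u j ^ 2 ≤ u ⬝ᵥ S.mulVec u := by
  have hpsd : (S - algebraMap ℝ _ c).PosSemidef := by
    rw [Matrix.posSemidef_iff_isHermitian_and_spectrum_nonneg]
    refine ⟨hS.sub ?_, fun μ hμ => ?_⟩
    · simp [Algebra.algebraMap_eq_smul_one, Matrix.IsHermitian]
    · rw [← spectrum.sub_singleton_eq] at hμ
      obtain ⟨ν, hν, _, rfl, rfl⟩ := Set.mem_sub.1 hμ
      exact sub_nonneg.2 (hc ν hν)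
  have hquad := hpsd.dotProduct_mulVec_nonneg u
  rw [Algebra.algebraMap_eq_smul_one, Matrix.sub_mulVec, Matrix.smul_mulVec, Matrix.one_mulVec,
    dotProduct_sub, dotProduct_smul] at hquad
  simpa [dotProduct, ← sq] using hquad

lemma integral_sq_sum_mul [IsFiniteMeasure P] {Y : Ω → Fin n → ℝ} {S : Matrix (Fin n) (Fin n) ℝ}
    (hY : ∀ j, MemLp (fun ω => Y ω j) 2 P) (hmean : ∀ j, ∫ ω, Y ω j ∂P = 0)
    (hcov : ∀ a b, cov[fun ω => Y ω a, fun ω => Y ω b; P] = S a b) (u : Fin n → ℝ) :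
    ∫ ω, (∑ j, u j * Y ω j) ^ 2 ∂P = u ⬝ᵥ S.mulVec u := by
  have hL2 (j) : MemLp (fun ω => u j * Y ω j) 2 P := (hY j).const_mul (u j)
  have hcentered : ∫ ω, ∑ j, u j * Y ω j ∂P = 0 := by
    rw [integral_finsetSum _ fun j _ => (hL2 j).integrable one_le_two]
    simp [integral_const_mul, hmean]
  rw [← variance_of_integral_eq_zero (memLp_finsetSum _ fun j _ => hL2 j).aemeasurable hcentered,
    variance_fun_sum hL2]
  simp only [covariance_const_mul_left, covariance_const_mul_right, hcov, dotProduct,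
    Matrix.mulVec, Finset.mul_sum]
  exact Finset.sum_congr rfl fun a _ => Finset.sum_congr rfl fun b _ => by ring

end SecondMoments

section Design

variable {Ω : Type*} [MeasurableSpace Ω] {P : Measure Ω} {N n : ℕ} {X : Ω → Fin N → Fin n → ℝ}
  {σ c : ℝ}

/-- A random design whose rows are independent `σ`-sub-Gaussian vectors, not necessarily identically
distributed, with `c ‖u‖₂² ≤ E (uᵀ X_i)²` for every row `X_i` and every vector `u`. -/
structure IsSubGaussianDesign (P : Measure Ω) (X : Ω → Fin N → Fin n → ℝ) (σ c : ℝ) : Prop where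
  measurable : Measurable X
  indep : iIndepFun (fun i ω => X ω i) P
  subGaussian : ∀ i, IsSubGaussianVec P (fun ω => X ω i) σ
  mul_sum_sq_le_integral : ∀ i (u : Fin n → ℝ),
    c * ∑ j, u j ^ 2 ≤ ∫ ω, (∑ j, u j * X ω i j) ^ 2 ∂P

lemma IsSubGaussianVec.hasSubgaussianMGF_apply {Y : Ω → Fin n → ℝ} (h : IsSubGaussianVec P Y σ)
    (j : Fin n) : HasSubgaussianMGF (fun ω => Y ω j) ⟨σ ^ 2, sq_nonneg σ⟩ P := by
  simpa [Pi.single_apply] using (h.2 (Pi.single j 1) (by simp [Pi.single_apply])).2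

lemma IsRowwiseSubGaussian.isHermitian {S : Matrix (Fin n) (Fin n) ℝ}
    (h : IsRowwiseSubGaussian P X σ S) (i : Fin N) : S.IsHermitian := by
  ext a b
  rw [Matrix.conjTranspose_apply, star_trivial, ← h.covariance i, ← h.covariance i,
    covariance_comm]

lemma IsRowwiseSubGaussian.isSubGaussianDesign [IsFiniteMeasure P]
    {S : Matrix (Fin n) (Fin n) ℝ} (h : IsRowwiseSubGaussian P X σ S)
    (hc : ∀ μ ∈ spectrum ℝ S, c ≤ μ) : IsSubGaussianDesign P X σ c where
  measurable := h.measurable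
  indep := h.indep
  subGaussian := h.subGaussian
  mul_sum_sq_le_integral i u := by
    rw [integral_sq_sum_mul (fun j => ((h.subGaussian i).hasSubgaussianMGF_apply j).memLp 2)
      (h.subGaussian i).1 (h.covariance i)]
    exact mul_sum_sq_le_dotProduct_mulVec (h.isHermitian i) hc u

namespace IsSubGaussianDesign

lemma measurable_apply (h : IsSubGaussianDesign P X σ c) (i : Fin N) (j : Fin n) :
    Measurable fun ω => X ω i j :=
  measurable_pi_iff.1 (measurable_pi_iff.1 h.measurable i) j

lemma iIndepFun_col (h : IsSubGaussianDesign P X σ c) (j : Fin n) :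
    iIndepFun (fun i ω => X ω i j) P :=
  h.indep.comp (fun _ x => x j) fun _ => measurable_pi_apply j

lemma hasSubgaussianMGF_apply (h : IsSubGaussianDesign P X σ c) (i : Fin N) (j : Fin n) :
    HasSubgaussianMGF (fun ω => X ω i j) ⟨σ ^ 2, sq_nonneg σ⟩ P :=
  (h.subGaussian i).hasSubgaussianMGF_apply j

lemma measureReal_sum_sq_le_half_le (h : IsSubGaussianDesign P X σ c) (hσ : 0 < σ) (hc : 0 ≤ c)
    {u : Fin n → ℝ} (hu : ∑ j, u j ^ 2 = 1) :
    P.real {ω | ∑ i, (∑ j, u j * X ω i j) ^ 2 ≤ N * (c / 2)}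
      ≤ Real.exp (-(c ^ 2 / (512 * σ ^ 4) * N)) := by
  have hind : iIndepFun (fun i ω => ∑ j, u j * X ω i j) P :=
    h.indep.comp (fun _ x => ∑ j, u j * x j) fun _ => by fun_prop
  have hmean (i : Fin N) : c ≤ ∫ ω, (∑ j, u j * X ω i j) ^ 2 ∂P := by
    simpa [hu] using h.mul_sum_sq_le_integral i u
  have hproxy : 0 < NNReal.mk (σ ^ 2) (sq_nonneg σ) := pow_pos hσ 2
  have key := measureReal_sum_sq_le_half_mean_le hind hproxy
    (fun i => ((h.subGaussian i).2 u hu).2) hc hmean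
  rw [Fintype.card_fin, NNReal.coe_mk, ← pow_mul] at key
  exact key

lemma measureReal_mulVec_lt_le [IsFiniteMeasure P] (h : IsSubGaussianDesign P X σ c) (hσ : 0 < σ)
    (hc : 0 ≤ c) (w : Fin n → ℝ) :
    P.real {ω | 1 / (N : ℝ) * ∑ i, (Matrix.of (X ω)).mulVec w i ^ 2 < c / 2 * ∑ j, w j ^ 2}
      ≤ Real.exp (-(c ^ 2 / (512 * σ ^ 4) * N)) := by
  rcases (Finset.sum_nonneg fun j _ => sq_nonneg (w j) : 0 ≤ ∑ j, w j ^ 2).eq_or_lt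
    with hw | hw
  · have hempty (ω) : ¬ 1 / (N : ℝ) * ∑ i, (Matrix.of (X ω)).mulVec w i ^ 2
        < c / 2 * ∑ j, w j ^ 2 := by
      rw [← hw, mul_zero, not_lt]
      positivity
    simp only [hempty, Set.ofPred_false, measureReal_empty]
    positivity
  · have hnorm : ∑ j, (w j / √(∑ j, w j ^ 2)) ^ 2 = 1 := by
      simp_rw [div_pow, Real.sq_sqrt hw.le, ← Finset.sum_div]
      exact div_self hw.ne'
    refine (measureReal_mono fun ω hω => ?_).trans (h.measureReal_sum_sq_le_half_le hσ hc hnorm)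
    have hscale (i) : (∑ j, w j / √(∑ j, w j ^ 2) * X ω i j) ^ 2
        = (Matrix.of (X ω)).mulVec w i ^ 2 / ∑ j, w j ^ 2 := by
      simp_rw [div_mul_eq_mul_div, ← Finset.sum_div, div_pow, Real.sq_sqrt hw.le]
      simp [Matrix.mulVec, dotProduct, mul_comm]
    rw [Set.mem_ofPred_eq] at hω ⊢
    simp_rw [hscale, ← Finset.sum_div]
    rw [div_le_iff₀ hw, mul_assoc]
    rcases (Nat.cast_nonneg N : (0 : ℝ) ≤ N).eq_or_lt with hN | hN
    · obtain rfl : N = 0 := by exact_mod_cast hN.symm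
      simp
    · rw [one_div, inv_mul_lt_iff₀ hN] at hω
      exact hω.le

lemma measureReal_col_lt_le [IsFiniteMeasure P] (h : IsSubGaussianDesign P X σ c) (hN : 0 < N)
    (hσ : 0 < σ) (j : Fin n) :
    P.real {ω | 8 * σ ^ 2 < 1 / (N : ℝ) * ∑ i, X ω i j ^ 2} ≤ Real.exp (-N) := by
  have hproxy : 0 < NNReal.mk (σ ^ 2) (sq_nonneg σ) := pow_pos hσ 2
  have key := measureReal_le_sum_sq_le (h.iIndepFun_col j) (fun i => h.measurable_apply i j)
    hproxy fun i => h.hasSubgaussianMGF_apply i j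
  rw [Fintype.card_fin, NNReal.coe_mk] at key
  refine (measureReal_mono fun ω hω => ?_).trans key
  rw [Set.mem_ofPred_eq, one_div, lt_inv_mul_iff₀ (by positivity)] at hω
  rw [Set.mem_ofPred_eq, mul_comm]
  exact hω.le

end IsSubGaussianDesign

end Design

section RestrictedEigenvalueProbability

variable {N n : ℕ} {κ τ : ℝ}

lemma RestrictedEigenvalue.mono {X : Matrix (Fin N) (Fin n) ℝ} {τ' : ℝ}
    (h : RestrictedEigenvalue X κ τ) (hτ : τ ≤ τ') : RestrictedEigenvalue X κ τ' :=
  fun v => (h v).trans (by gcongr)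

lemma restrictedEigenvalue_of_le (X : Matrix (Fin N) (Fin n) ℝ) (hτ : 0 ≤ τ) (hκ : κ ≤ τ) :
    RestrictedEigenvalue X κ τ := fun v => by
  have hnorm : ∑ j, v j ^ 2 ≤ (∑ j, |v j|) ^ 2 := by
    simpa using Finset.sum_sq_le_sq_sum_of_nonneg (s := Finset.univ) (f := fun j => |v j|)
      fun _ _ => abs_nonneg _
  calc κ * ∑ j, v j ^ 2 ≤ τ * (∑ j, |v j|) ^ 2 := by gcongr
    _ ≤ 1 / (N : ℝ) * ∑ i, X.mulVec v i ^ 2 + τ * (∑ j, |v j|) ^ 2 :=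
      le_add_of_nonneg_left (by positivity)

variable {Ω : Type*} [MeasurableSpace Ω] {P : Measure Ω} {X : Ω → Fin N → Fin n → ℝ} {σ c : ℝ}

lemma IsSubGaussianDesign.measureReal_not_restrictedEigenvalue_sparse_le [IsFiniteMeasure P]
    (h : IsSubGaussianDesign P X σ c) (hN : 0 < N) (hσ : 0 < σ) (hc : 0 ≤ c) {s : ℕ}
    (hs : 2 ≤ s) :
    P.real {ω | ¬ RestrictedEigenvalue (Matrix.of (X ω)) (c / 2) (8 * σ ^ 2 / (s - 1))}
      ≤ (2 * n) ^ s * Real.exp (-(c ^ 2 / (512 * σ ^ 4) * N)) + n * Real.exp (-N) := by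
  set E := fun f : Fin s → Fin n × Bool =>
    {ω | 1 / (N : ℝ) * ∑ l, (Matrix.of (X ω)).mulVec (∑ i, signedBasis (f i)) l ^ 2
      < c / 2 * ∑ j, (∑ i, signedBasis (f i)) j ^ 2} with hE
  set F := fun j : Fin n => {ω | 8 * σ ^ 2 < 1 / (N : ℝ) * ∑ i, X ω i j ^ 2} with hF
  have hsub : {ω | ¬ RestrictedEigenvalue (Matrix.of (X ω)) (c / 2) (8 * σ ^ 2 / (s - 1))}
      ⊆ (⋃ f, E f) ∪ ⋃ j, F j := by
    intro ω hω
    contrapose! hω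
    simp only [hE, hF, Set.mem_union, Set.mem_iUnion, Set.mem_ofPred_eq, not_or, not_exists,
      not_lt] at hω
    rw [Set.mem_ofPred_eq, not_not]
    exact restrictedEigenvalue_of_sparse (by positivity) hs hω.1 hω.2
  refine (measureReal_mono hsub).trans <| (measureReal_union_le _ _).trans <| add_le_add ?_ ?_
  · refine (measureReal_iUnion_fintype_le _).trans <|
      (Finset.sum_le_sum fun f _ => h.measureReal_mulVec_lt_le hσ hc _).trans_eq ?_
    simp [mul_comm]
  · refine (measureReal_iUnion_fintype_le _).trans <|
      (Finset.sum_le_sum fun j _ => h.measureReal_col_lt_le hN hσ j).trans_eq ?_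
    simp

/-- The exponential rate, per observation, at which the restricted eigenvalue condition of a
`σ`-sub-Gaussian design with second moments at least `c` fails. -/
noncomputable def reRate (σ c : ℝ) : ℝ := min (c ^ 2 / (2048 * σ ^ 4)) (1 / 2)

/-- The constant in front of `log n / N` in the `ℓ₁`-tolerance of the restricted eigenvalue
condition of a `σ`-sub-Gaussian design with second moments at least `c`. -/
noncomputable def reTol (σ c : ℝ) : ℝ := (c + 24 * σ ^ 2) / reRate σ c

lemma reRate_pos (hσ : 0 < σ) (hc : 0 < c) : 0 < reRate σ c :=
  lt_min (by positivity) (by norm_num)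

lemma reTol_nonneg (hσ : 0 < σ) (hc : 0 < c) : 0 ≤ reTol σ c :=
  div_nonneg (by positivity) (reRate_pos hσ hc).le

lemma half_le_reTol_mul (hσ : 0 < σ) (hc : 0 < c) {ρ : ℝ} (hρ : 0 < ρ)
    (hs : reRate σ c ≤ 2 * ρ) : c / 2 ≤ reTol σ c * ρ := by
  rw [reTol, div_mul_eq_mul_div, le_div_iff₀ (reRate_pos hσ hc)]
  calc c / 2 * reRate σ c ≤ c / 2 * (2 * ρ) := by gcongr
    _ = c * ρ := by ring
    _ ≤ (c + 24 * σ ^ 2) * ρ := by gcongr; exact le_add_of_nonneg_right (by positivity)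

lemma div_sub_one_le_reTol_mul (hσ : 0 < σ) (hc : 0 < c) {ρ : ℝ} (hρ : 0 < ρ) {s : ℕ}
    (hs : 2 ≤ s) (hrate : reRate σ c ≤ (s + 1) * ρ) : 8 * σ ^ 2 / (s - 1) ≤ reTol σ c * ρ := by
  have hs' : (2 : ℝ) ≤ s := by exact_mod_cast hs
  rw [reTol, div_mul_eq_mul_div, div_le_div_iff₀ (by linarith) (reRate_pos hσ hc)]
  have hs₁ : 0 ≤ (s : ℝ) - 1 := by linarith
  calc 8 * σ ^ 2 * reRate σ c ≤ 8 * σ ^ 2 * ((3 * (s - 1)) * ρ) := by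
        gcongr
        exact hrate.trans (by gcongr; linarith)
    _ = 24 * σ ^ 2 * ρ * (s - 1) := by ring
    _ ≤ (c + 24 * σ ^ 2) * ρ * (s - 1) := by gcongr; exact le_add_of_nonneg_left hc.le

lemma pow_mul_exp_add_mul_exp_le (hn : 2 ≤ n) {s : ℕ} (hs : 1 ≤ s)
    (hlog : s * Real.log n ≤ reRate σ c * N) :
    (2 * n : ℝ) ^ s * Real.exp (-(c ^ 2 / (512 * σ ^ 4) * N)) + n * Real.exp (-N)
      ≤ 2 * Real.exp (-(reRate σ c * N)) := by
  have hn' : (2 : ℝ) ≤ n := by exact_mod_cast hn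
  have hs' : (1 : ℝ) ≤ s := by exact_mod_cast hs
  have hexp : (n : ℝ) = Real.exp (Real.log n) := (Real.exp_log (by linarith)).symm
  have hrate : 4 * reRate σ c ≤ c ^ 2 / (512 * σ ^ 4) :=
    calc 4 * reRate σ c ≤ 4 * (c ^ 2 / (2048 * σ ^ 4)) := by gcongr; exact min_le_left _ _
      _ = c ^ 2 / (512 * σ ^ 4) := by ring
  have hrate_half : reRate σ c ≤ 1 / 2 := min_le_right _ _
  have hpow : (2 * n : ℝ) ^ s ≤ Real.exp (2 * (s * Real.log n)) :=
    calc (2 * n : ℝ) ^ s ≤ (n * n) ^ s := by gcongr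
      _ = Real.exp (s * (Real.log n + Real.log n)) := by
        rw [Real.exp_nat_mul, Real.exp_add, ← hexp]
      _ = Real.exp (2 * (s * Real.log n)) := by ring_nf
  rw [two_mul (Real.exp _)]
  gcongr ?_ + ?_
  · refine (mul_le_mul_of_nonneg_right hpow (Real.exp_nonneg _)).trans ?_
    rw [← Real.exp_add, Real.exp_le_exp]
    have := mul_le_mul_of_nonneg_right hrate (Nat.cast_nonneg N)
    nlinarith [Real.log_nonneg (by linarith : (1 : ℝ) ≤ n)]
  · nth_rewrite 1 [hexp]
    rw [← Real.exp_add, Real.exp_le_exp]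
    have := mul_le_mul_of_nonneg_right hrate_half (Nat.cast_nonneg N)
    nlinarith [Real.log_nonneg (by linarith : (1 : ℝ) ≤ n)]

-- The sparsity `⌊reRate σ c * N / log n⌋` balances the entropy of the sparse directions against
-- the concentration of each of them.
theorem IsSubGaussianDesign.measureReal_not_restrictedEigenvalue_le [IsFiniteMeasure P]
    (h : IsSubGaussianDesign P X σ c) (hN : 0 < N) (hn : 2 ≤ n) (hσ : 0 < σ) (hc : 0 < c) :
    P.real {ω | ¬ RestrictedEigenvalue (Matrix.of (X ω)) (c / 2)
        (reTol σ c * (Real.log n / N))} ≤ 2 * Real.exp (-(reRate σ c * N)) := by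
  have hN' : (0 : ℝ) < N := by exact_mod_cast hN
  have hρ : 0 < Real.log n / N := div_pos (Real.log_pos (by exact_mod_cast hn)) hN'
  have hratio : 0 < reRate σ c / (Real.log n / N) := div_pos (reRate_pos hσ hc) hρ
  set s := ⌊reRate σ c / (Real.log n / N)⌋₊
  have hs_lt : reRate σ c ≤ (s + 1) * (Real.log n / N) :=
    ((div_lt_iff₀ hρ).1 (Nat.lt_floor_add_one _)).le
  rcases lt_or_ge s 2 with hs | hs
  · have hs' : (s : ℝ) + 1 ≤ 2 := by exact_mod_cast hs
    have hκ := half_le_reTol_mul hσ hc hρ (hs_lt.trans (by gcongr))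
    have htol := mul_nonneg (reTol_nonneg hσ hc) hρ.le
    simp only [restrictedEigenvalue_of_le _ htol hκ, not_true_eq_false, Set.ofPred_false,
      measureReal_empty]
    positivity
  · have hlog : s * Real.log n ≤ reRate σ c * N := by
      have := (le_div_iff₀ hρ).1 (Nat.floor_le hratio.le)
      rwa [mul_div_assoc', div_le_iff₀ hN'] at this
    calc P.real {ω | ¬ RestrictedEigenvalue (Matrix.of (X ω)) (c / 2)
          (reTol σ c * (Real.log n / N))}
        ≤ P.real {ω | ¬ RestrictedEigenvalue (Matrix.of (X ω)) (c / 2)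
          (8 * σ ^ 2 / (s - 1))} :=
          measureReal_mono fun ω hω hX => hω (hX.mono (div_sub_one_le_reTol_mul hσ hc hρ hs hs_lt))
      _ ≤ _ := h.measureReal_not_restrictedEigenvalue_sparse_le hN hσ hc.le hs
      _ ≤ 2 * Real.exp (-(reRate σ c * N)) :=
          pow_mul_exp_add_mul_exp_le hn (by lia) hlog

end RestrictedEigenvalueProbability

section NoiseLevel

variable {Ω : Type*} [MeasurableSpace Ω] {P : Measure Ω} {N n : ℕ} {X : Ω → Fin N → Fin n → ℝ}
  {ε : Ω → Fin N → ℝ} {σ c σε : ℝ}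

lemma measure_energy_le (hε : Measurable ε) (hind : iIndepFun (fun i ω => ε ω i) P)
    (hsub : ∀ i, IsSubGaussian P (fun ω => ε ω i) σε) (hσε : 0 < σε) :
    P {ω | 8 * σε ^ 2 * N ≤ ∑ i, ε ω i ^ 2} ≤ ENNReal.ofReal (Real.exp (-N)) := by
  have := hind.isProbabilityMeasure
  have hproxy : 0 < NNReal.mk (σε ^ 2) (sq_nonneg σε) := pow_pos hσε 2
  have key := measureReal_le_sum_sq_le hind (measurable_pi_iff.1 hε) hproxy fun i => (hsub i).2
  rw [Fintype.card_fin, NNReal.coe_mk] at key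
  exact (ENNReal.le_ofReal_iff_toReal_le (measure_ne_top _ _) (Real.exp_nonneg _)).2 key

lemma neg_sq_div_eq_neg_four_mul_log (hN : 0 < N) (hσ : 0 < σ) (hσε : 0 < σε) :
    -(N * (8 * σ * (σε * √(Real.log n / N)))) ^ 2 / (2 * (8 * σε ^ 2 * N * σ ^ 2))
      = -(4 * Real.log n) := by
  have hN' : (N : ℝ) ≠ 0 := by exact_mod_cast hN.ne'
  have hsqrt : √(Real.log n / N) ^ 2 = Real.log n / N :=
    Real.sq_sqrt (div_nonneg (Real.log_natCast_nonneg n) N.cast_nonneg)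
  simp only [mul_pow, hsqrt]
  field_simp
  ring

lemma mul_exp_neg_four_mul_log_le (hn : 2 ≤ n) :
    n * (2 * Real.exp (-(4 * Real.log n))) ≤ 2 / n := by
  have hn' : (2 : ℝ) ≤ n := by exact_mod_cast hn
  have hlog : 0 ≤ Real.log n := Real.log_nonneg (by linarith)
  calc n * (2 * Real.exp (-(4 * Real.log n)))
      ≤ n * (2 * Real.exp (-(Real.log n + Real.log n))) := by gcongr; linarith
    _ = 2 / n := by
      rw [Real.exp_neg, Real.exp_add, Real.exp_log (by linarith)]
      field_simp

-- Conditionally on a noise vector of energy `‖ε‖₂² ≤ 8 σε² N`, each score `X_jᵀ ε` is sub-Gaussian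
-- with variance proxy `8 σ² σε² N`.
theorem IsSubGaussianDesign.measure_not_forall_abs_score_le (h : IsSubGaussianDesign P X σ c)
    (hε : Measurable ε) (hind : iIndepFun (fun i ω => ε ω i) P)
    (hsub : ∀ i, IsSubGaussian P (fun ω => ε ω i) σε) (hXε : IndepFun X ε P) (hN : 0 < N)
    (hn : 2 ≤ n) (hσ : 0 < σ) (hσε : 0 < σε) {lam : ℝ}
    (hlam : 32 * σ * (σε * √(Real.log n / N)) ≤ lam) :
    P {ω | ¬ ∀ j, |∑ i, X ω i j * ε ω i| ≤ N * (lam / 4)}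
      ≤ ENNReal.ofReal (Real.exp (-N) + 2 / n) := by
  set V : NNReal := .mk (8 * σε ^ 2 * N) (by positivity)
  set u : ℝ := N * (8 * σ * (σε * √(Real.log n / N))) with hu
  have hcol (j : Fin n) : P {ω | ∑ i, ε ω i ^ 2 ≤ V ∧ u < |∑ i, ε ω i * X ω i j|}
      ≤ ENNReal.ofReal (2 * Real.exp (-(4 * Real.log n))) := by
    have hcol_measurable : Measurable fun (x : Fin N → Fin n → ℝ) i => x i j := by fun_prop
    have hXε_col : IndepFun (fun ω i => X ω i j) ε P := hXε.comp hcol_measurable measurable_id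
    rw [← neg_sq_div_eq_neg_four_mul_log hN hσ hσε]
    exact measure_sum_sq_le_and_lt_abs_sum_mul_le (h.iIndepFun_col j)
      (fun i => h.measurable_apply i j) (fun i => h.hasSubgaussianMGF_apply i j) hε hXε_col
      V (by positivity)
  have hsubset : {ω | ¬ ∀ j, |∑ i, X ω i j * ε ω i| ≤ N * (lam / 4)}
      ⊆ {ω | 8 * σε ^ 2 * N ≤ ∑ i, ε ω i ^ 2}
        ∪ ⋃ j, {ω | ∑ i, ε ω i ^ 2 ≤ V ∧ u < |∑ i, ε ω i * X ω i j|} := by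
    intro ω hω
    obtain ⟨j, hj⟩ := not_forall.1 hω
    refine (le_total (V : ℝ) (∑ i, ε ω i ^ 2)).imp id fun hV => Set.mem_iUnion.2 ⟨j, hV, ?_⟩
    simp only [mul_comm (ε ω _)]
    refine lt_of_le_of_lt ?_ (not_le.1 hj)
    rw [hu]
    gcongr
    linarith
  calc P {ω | ¬ ∀ j, |∑ i, X ω i j * ε ω i| ≤ N * (lam / 4)}
      ≤ ENNReal.ofReal (Real.exp (-N))
        + ∑ _j : Fin n, ENNReal.ofReal (2 * Real.exp (-(4 * Real.log n))) :=
        (measure_mono hsubset).trans <| (measure_union_le _ _).trans <|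
          add_le_add (measure_energy_le hε hind hsub hσε) <|
            (measure_iUnion_fintype_le _ _).trans (Finset.sum_le_sum fun j _ => hcol j)
    _ = ENNReal.ofReal (Real.exp (-N) + n * (2 * Real.exp (-(4 * Real.log n)))) := by
        rw [ENNReal.ofReal_add (by positivity) (by positivity), Finset.sum_const,
          Finset.card_univ, Fintype.card_fin, ← ENNReal.ofReal_nsmul, nsmul_eq_mul]
    _ ≤ ENNReal.ofReal (Real.exp (-N) + 2 / n) := by
        gcongr
        exact mul_exp_neg_four_mul_log_le hn

end NoiseLevel

section StochasticBoundedness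

lemma isBigOP_of_tendsto_measure_compl {Ω : ℕ → Type*} [∀ t, MeasurableSpace (Ω t)]
    {P : ∀ t, Measure (Ω t)} {good : ∀ t, Ω t → Prop}
    (hgood : Tendsto (fun t => P t {ω | ¬ good t ω}) atTop (nhds 0)) {Y : ∀ t, Ω t → ℝ}
    {a : ℕ → ℝ} {M : ℝ} (hM : 0 < M) (hY : ∀ᶠ t in atTop, ∀ ω, good t ω → |Y t ω| ≤ M * a t) :
    IsBigOP P Y a := fun δ hδ => by
  refine ⟨M, hM, ?_⟩
  filter_upwards [hY, hgood.eventually_le_const (ENNReal.ofReal_pos.2 hδ)] with t ht hδt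
  refine (measure_mono fun ω hω hω' => ?_).trans hδt
  exact hω.not_ge ((ht ω hω').trans (by gcongr; exact le_abs_self _))

lemma tendsto_exp_neg_add_two_div_add_exp_neg {r : ℝ} (hr : 0 < r) {N n : ℕ → ℕ}
    (hN : Tendsto N atTop atTop) (hn : Tendsto n atTop atTop) :
    Tendsto (fun t => Real.exp (-(N t : ℝ)) + 2 / (n t : ℝ) + 2 * Real.exp (-(r * N t))) atTop
      (nhds 0) := by
  have hN' := tendsto_natCast_atTop_atTop (R := ℝ).comp hN
  have hn' := tendsto_natCast_atTop_atTop (R := ℝ).comp hn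
  have hexp := Real.tendsto_exp_neg_atTop_nhds_zero.comp hN'
  have hexp_mul := Real.tendsto_exp_neg_atTop_nhds_zero.comp (hN'.const_mul_atTop hr)
  simpa using (hexp.add (hn'.const_div_atTop 2)).add (hexp_mul.const_mul 2)

lemma tendsto_measure_not_restrictedEigenvalue_and_abs_score_le {σ c : ℝ} (hσ : 0 < σ) (hc : 0 < c)
    {N n : ℕ → ℕ} (hN : Tendsto N atTop atTop) (hn : Tendsto n atTop atTop) {σε lam : ℕ → ℝ}
    (hσε : ∀ t, 0 < σε t)
    (hlam : ∀ t, 32 * σ * (σε t * √(Real.log (n t) / N t)) ≤ lam t)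
    {Ω : ℕ → Type*} [∀ t, MeasurableSpace (Ω t)] {P : ∀ t, Measure (Ω t)}
    {X : ∀ t, Ω t → Fin (N t) → Fin (n t) → ℝ} {ε : ∀ t, Ω t → Fin (N t) → ℝ}
    (hX : ∀ t, IsSubGaussianDesign (P t) (X t) σ c) (hε : ∀ t, Measurable (ε t))
    (hind : ∀ t, iIndepFun (fun i ω => ε t ω i) (P t))
    (hsub : ∀ t i, IsSubGaussian (P t) (fun ω => ε t ω i) (σε t))
    (hXε : ∀ t, IndepFun (X t) (ε t) (P t)) :
    Tendsto (fun t => P t {ω | ¬ (RestrictedEigenvalue (Matrix.of (X t ω)) (c / 2)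
        (reTol σ c * (Real.log (n t) / N t)) ∧
      ∀ j, |∑ i, X t ω i j * ε t ω i| ≤ N t * (lam t / 4))}) atTop (nhds 0) := by
  have hlim := ENNReal.tendsto_ofReal
    (tendsto_exp_neg_add_two_div_add_exp_neg (reRate_pos hσ hc) hN hn)
  rw [ENNReal.ofReal_zero] at hlim
  refine tendsto_of_tendsto_of_tendsto_of_le_of_le' tendsto_const_nhds hlim
    (.of_forall fun _ => zero_le) ?_
  filter_upwards [hN.eventually_gt_atTop 0, hn.eventually_ge_atTop 2] with t hNt hnt
  have := (hind t).isProbabilityMeasure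
  have hnoise :=
    (hX t).measure_not_forall_abs_score_le (hε t) (hind t) (hsub t) (hXε t) hNt hnt hσ (hσε t)
      (hlam t)
  have hRE := (ENNReal.le_ofReal_iff_toReal_le (measure_ne_top _ _) (by positivity)).2
    ((hX t).measureReal_not_restrictedEigenvalue_le hNt hnt hσ hc)
  rw [ENNReal.ofReal_add (by positivity) (by positivity), add_comm]
  refine (measure_mono fun ω hω => ?_).trans <| (measure_union_le _ _).trans (add_le_add hRE hnoise)
  exact not_and_or.1 hω

end StochasticBoundedness

end GraphLasso

theorem theorem4_general {σx c σ₀ q₁ q₂ : ℝ} (hσx : 0 < σx) (hc : 0 < c) (hσ₀ : 0 < σ₀)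
    (hq₁ : q₁ ∈ Set.Ioc 0 1) (hq₂ : q₂ ∈ Set.Ioc 0 1) (C₁ K : ℝ) {N n : ℕ → ℕ}
    (hN : Tendsto N atTop atTop) (hn : Tendsto n atTop atTop) {σε R₁ R₂ lam lamg : ℕ → ℝ}
    (hσε : ∀ t, σ₀ ≤ σε t)
    (hK : ∀ t, R₁ t * (Real.log (n t) / N t) ^ (1 - q₁ / 2)
      + R₂ t * (Real.log (n t) / N t) ^ (1 - q₂ / 2) ≤ K)
    (hlam : ∀ t, 32 * σx * (σε t * √(Real.log (n t) / N t)) ≤ lam t)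
    (hlam' : ∀ t, lam t ≤ C₁ * (σε t * √(Real.log (n t) / N t)))
    {m : ℕ → Type*} [∀ t, Fintype (m t)] {D : ∀ t, Matrix (m t) (Fin (n t)) ℝ}
    (hD : ∀ t, GraphLasso.IsAdmissiblePenalty (D t) (lamg t) (lam t))
    {βstar : ∀ t, Fin (n t) → ℝ} (hDβ : ∀ t, ∑ i, |(D t).mulVec (βstar t) i| ^ q₁ ≤ R₁ t)
    (hβ : ∀ t, ∑ j, |βstar t j| ^ q₂ ≤ R₂ t)
    {Ω : ℕ → Type*} [∀ t, MeasurableSpace (Ω t)] {P : ∀ t, Measure (Ω t)}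
    {X : ∀ t, Ω t → Fin (N t) → Fin (n t) → ℝ} {ε : ∀ t, Ω t → Fin (N t) → ℝ}
    {βhat : ∀ t, Ω t → Fin (n t) → ℝ}
    (hX : ∀ t, GraphLasso.IsSubGaussianDesign (P t) (X t) σx c) (hε : ∀ t, Measurable (ε t))
    (hind : ∀ t, iIndepFun (fun i ω => ε t ω i) (P t))
    (hsub : ∀ t i, GraphLasso.IsSubGaussian (P t) (fun ω => ε t ω i) (σε t))
    (hXε : ∀ t, IndepFun (X t) (ε t) (P t))
    (hβhat : ∀ t ω, IsMinOn (GraphLasso.genLassoObjective (D t) (lamg t) (lam t)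
      (Matrix.of (X t ω)) ((Matrix.of (X t ω)).mulVec (βstar t) + ε t ω)) Set.univ (βhat t ω)) :
    GraphLasso.IsBigOP P (fun t ω => ∑ j, (βhat t ω j - βstar t j) ^ 2)
      (fun t => σε t ^ 2 * (R₁ t * (Real.log (n t) / N t) ^ (1 - q₁ / 2)
        + R₂ t * (Real.log (n t) / N t) ^ (1 - q₂ / 2))) ∧
    GraphLasso.IsBigOP P
      (fun t ω => 1 / (N t : ℝ) * ∑ i, ((Matrix.of (X t ω)).mulVec (βhat t ω - βstar t) i) ^ 2)
      (fun t => σε t ^ 2 * (R₁ t * (Real.log (n t) / N t) ^ (1 - q₁ / 2)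
        + R₂ t * (Real.log (n t) / N t) ^ (1 - q₂ / 2))) ∧
    GraphLasso.IsBigOP P (fun t ω => (∑ j, |βhat t ω j - βstar t j|) ^ 2)
      (fun t => σε t ^ 2 * (R₁ t ^ 2 * (Real.log (n t) / N t) ^ (1 - q₁)
        + R₂ t ^ 2 * (Real.log (n t) / N t) ^ (1 - q₂))) := by
  have hσε_pos (t) : 0 < σε t := hσ₀.trans_le (hσε t)
  obtain ⟨M, hM, hbounds⟩ := GraphLasso.exists_error_bounds (half_pos hc)
    (GraphLasso.reTol_nonneg hσx hc) hσ₀ hq₁ hq₂ C₁ K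
  have hgood := GraphLasso.tendsto_measure_not_restrictedEigenvalue_and_abs_score_le hσx hc hN hn
    hσε_pos hlam hX hε hind hsub hXε
  have hregime : ∀ᶠ t in atTop, 0 < N t ∧ 0 < Real.log (n t) / N t ∧ 0 < lam t := by
    filter_upwards [hN.eventually_gt_atTop 0, hn.eventually_ge_atTop 2] with t hNt hnt
    have hρ : 0 < Real.log (n t) / N t :=
      div_pos (Real.log_pos (by exact_mod_cast hnt)) (Nat.cast_pos.2 hNt)
    exact ⟨hNt, hρ, lt_of_lt_of_le (by have := hσε_pos t; positivity) (hlam t)⟩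
  have herror (t ω) (ht : 0 < N t ∧ 0 < Real.log (n t) / N t ∧ 0 < lam t) :=
    hbounds ht.1 ht.2.1 (hσε t) ht.2.2 (hlam' t) (hD t) (hDβ t) (hβ t) (hK t) (hβhat t ω)
  refine ⟨GraphLasso.isBigOP_of_tendsto_measure_compl hgood hM ?_,
    GraphLasso.isBigOP_of_tendsto_measure_compl hgood hM ?_,
    GraphLasso.isBigOP_of_tendsto_measure_compl hgood hM ?_⟩
  all_goals filter_upwards [hregime] with t ht ω hω
  all_goals have hω_error := herror t ω ht hω.1 hω.2
  all_goals rw [abs_of_nonneg (by positivity)]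
  exacts [hω_error.1, hω_error.2.1, hω_error.2.2]

theorem theorem4
    -- sub-Gaussian parameter of the design
    (σx : ℝ) (hσx : 0 < σx)
    -- dimension-free eigenvalue bounds
    (cl cu : ℝ) (hcl : 0 < cl) :
    ∃ C₀ : ℝ, 0 < C₀ ∧
      ∀ (k : ℕ) (q₁ q₂ : ℝ), 0 < q₁ → q₁ < 1 → 0 < q₂ → q₂ < 1 →
      ∀ (C₁ K σ₀ : ℝ), 0 < σ₀ →
      -- a sequence of problems with `N` observations, `n` nodes and noise level `σε`
      ∀ (N n : ℕ → ℕ), Tendsto N atTop atTop → Tendsto n atTop atTop →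
      ∀ (σε : ℕ → ℝ), (∀ t, σ₀ ≤ σε t) →
      ∀ (R₁ R₂ : ℕ → ℝ), (∀ t, 0 < R₁ t) → (∀ t, 0 < R₂ t) →
      (∀ t, R₁ t * (Real.log (n t) / N t) ^ (1 - q₁ / 2)
          + R₂ t * (Real.log (n t) / N t) ^ (1 - q₂ / 2) ≤ K) →
      ∀ (G : ∀ t, SimpleGraph (Fin (n t))) (βstar : ∀ t, Fin (n t) → ℝ),
      (∀ t, βstar t ∈ GraphLasso.weakSpace (G t) k q₁ q₂ (R₁ t) (R₂ t)) →
      ∀ (lam lamg : ℕ → ℝ),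
      (∀ t, C₀ * (σε t * Real.sqrt (Real.log (n t) / N t)) ≤ lam t ∧
          lam t ≤ C₁ * (σε t * Real.sqrt (Real.log (n t) / N t))) →
      (∀ t, lamg t = (2 : ℝ) ^ (-(1 + (k : ℝ) / 2))
          * (GraphLasso.maxDeg (G t) : ℝ) ^ (-(((k : ℝ) + 1) / 2)) * lam t) →
      ∀ (Ω : ℕ → Type*) [∀ t, MeasurableSpace (Ω t)] (P : ∀ t, Measure (Ω t))
        [∀ t, IsProbabilityMeasure (P t)]
        (S : ∀ t, Matrix (Fin (n t)) (Fin (n t)) ℝ)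
        (X : ∀ t, Ω t → Fin (N t) → Fin (n t) → ℝ) (ε : ∀ t, Ω t → Fin (N t) → ℝ)
        (y : ∀ t, Ω t → Fin (N t) → ℝ) (βhat : ∀ t, Ω t → Fin (n t) → ℝ),
      (∀ t, GraphLasso.IsRowwiseSubGaussian (P t) (X t) σx (S t)) →
      (∀ t, ∀ μ ∈ spectrum ℝ (S t), cl ≤ μ ∧ μ ≤ cu) →
      (∀ t, GraphLasso.IsSubGaussianNoise (P t) (ε t) (σε t)) →
      (∀ t, IndepFun (X t) (ε t) (P t)) →
      (∀ t ω, y t ω = (Matrix.of (X t ω)).mulVec (βstar t) + ε t ω) →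
      (∀ t ω, GraphLasso.IsGPPLasso (G t) k (lamg t) (lam t)
          (Matrix.of (X t ω)) (y t ω) (βhat t ω)) →
      -- squared `ℓ₂` error
      GraphLasso.IsBigOP P (fun t ω => ∑ j, (βhat t ω j - βstar t j) ^ 2)
        (fun t => σε t ^ 2 * (R₁ t * (Real.log (n t) / N t) ^ (1 - q₁ / 2)
          + R₂ t * (Real.log (n t) / N t) ^ (1 - q₂ / 2))) ∧
      -- prediction error
      GraphLasso.IsBigOP P
        (fun t ω => 1 / (N t : ℝ) *
          ∑ i, ((Matrix.of (X t ω)).mulVec (βhat t ω - βstar t) i) ^ 2)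
        (fun t => σε t ^ 2 * (R₁ t * (Real.log (n t) / N t) ^ (1 - q₁ / 2)
          + R₂ t * (Real.log (n t) / N t) ^ (1 - q₂ / 2))) ∧
      -- squared `ℓ₁` error
      GraphLasso.IsBigOP P (fun t ω => (∑ j, |βhat t ω j - βstar t j|) ^ 2)
        (fun t => σε t ^ 2 * (R₁ t ^ 2 * (Real.log (n t) / N t) ^ (1 - q₁)
          + R₂ t ^ 2 * (Real.log (n t) / N t) ^ (1 - q₂))) := by
  refine ⟨32 * σx, by positivity, ?_⟩
  intro k q₁ q₂ hq₁ hq₁' hq₂ hq₂' C₁ K σ₀ hσ₀ N n hN hn σε hσε R₁ R₂ _ _ hK G βstar hβ lam lamg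
    hlam hlamg Ω _ P _ S X ε y βhat hX hS hε hXε hy hβhat
  have hlam_nonneg (t) : 0 ≤ lam t :=
    le_trans (by have := hσ₀.trans_le (hσε t); positivity) (hlam t).1
  refine theorem4_general hσx hcl hσ₀ ⟨hq₁, hq₁'.le⟩ ⟨hq₂, hq₂'.le⟩ C₁ K hN hn hσε hK
    (fun t => (hlam t).1) (fun t => (hlam t).2)
    (fun t => hlamg t ▸ GraphLasso.isAdmissiblePenalty_graphDiff (G t) k (hlam_nonneg t))
    (fun t => (hβ t).1) (fun t => (hβ t).2)
    (fun t => (hX t).isSubGaussianDesign fun μ hμ => (hS t μ hμ).1) (fun t => (hε t).measurable)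
    (fun t => (hε t).indep) (fun t => (hε t).subGaussian) hXε fun t ω => ?_
  exact isMinOn_univ_iff.2 fun β => hy t ω ▸ hβhat t ω β
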